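/- Let $\mathbb H=\{(z_1,z_2)\in\mathbb C^2:|z_1|<|z_2|<1\}$ be the Hartogs triangle, $dV$ Lebesgue measure, $du=|w_2|^{-2}dV$, and let $P$ be the Bergman projection of $\mathbb H$, that is, the orthogonal projection of $L^2(\mathbb H,dV)$ onto its subspace $A^2(\mathbb H)$ of holomorphic functions. For $z$ in the unit disc $\mathbb D$ let $T_0=\mathbb D$ and $T_z=\{w\in\mathbb D:|1-\bar w\,z/|z||<1-|z|\}$ if $z\neq0$, and for $z_1,z_2\in\mathbb D$ let $$T'_{z_1,z_2}=\{(w_1,w_2)\in\mathbb H: w_1/w_2\in T_{z_1},\ w_2\in T_{z_2}\}.$$ A weight on $\mathbb H$ is an (almost everywhere) positive, locally integrable function on $\mathbb H$. For $1<p<\infty$, $p'=p/(p-1)$ and a weight $\mu$, put $\nu=|w_2|^{-p'}\mu^{-p'/p}$ and $$[\mu,\nu]_p=\sup_{z_1,z_2\in\mathbb D}\left(\frac{1}{u(T'_{z_1,z_2})}\int_{T'_{z_1,z_2}}\mu\,|w_2|^{2-p}\,du\right)\left(\frac{1}{u(T'_{z_1,z_2})}\int_{T'_{z_1,z_2}}|w_2|^{2}\,\nu\,du\right)^{p-1}\in[0,\infty].$$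 $P$ is bounded on $L^p(\mathbb H,\mu\,dV)$ if there is a finite $A$ with $\|Pf\|_{L^p(\mathbb H,\mu dV)}\le A\,\|f\|_{L^p(\mathbb H,\mu dV)}$ for all $f\in L^2(\mathbb H,dV)\cap L^p(\mathbb H,\mu\,dV)$; the least such $A$ is denoted $\|P\|_{L^p(\mathbb H,\mu dV)}$. There is an absolute constant $C>0$ such that for every $1<p<\infty$ and every weight $\mu$ on $\mathbb H$ (not assumed to be of the form $\mu_1(z_1/z_2)\mu_2(z_2)$): if $P$ is bounded on $L^p(\mathbb H,\mu\,dV)$, then $[\mu,\nu]_p<\infty$ and $$[\mu,\nu]_p^{\frac1{2p}}\le C\,\|P\|_{L^p(\mathbb H,\mu dV)}.$$ -/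

import Mathlib

open MeasureTheory
open scoped ENNReal NNReal ComplexConjugate

noncomputable section

namespace HartogsBergman

/-- The Hartogs triangle `{(z₁, z₂) ∈ ℂ² : |z₁| < |z₂| < 1}`. The measure `volume` on `ℂ × ℂ`
is the Lebesgue measure `dV`. -/
def hartogs : Set (ℂ × ℂ) := {z | ‖z.1‖ < ‖z.2‖ ∧ ‖z.2‖ < 1}

/-- The open unit disc in `ℂ`. -/
def disc : Set ℂ := {z | ‖z‖ < 1}

/-- The space `L²(Ω)` with respect to Lebesgue measure. -/
abbrev L2 (Ω : Set (ℂ × ℂ)) : Type := Lp ℂ 2 ((volume : Measure (ℂ × ℂ)).restrict Ω)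

/-- The Bergman space `A²(Ω)`: the classes in `L²(Ω)` of functions that are holomorphic on `Ω`
(for open `Ω`, complex Fréchet differentiability on `Ω`). -/
def bergmanSpace (Ω : Set (ℂ × ℂ)) : Submodule ℂ (L2 Ω) where
  carrier := {f | ∃ g : ℂ × ℂ → ℂ, DifferentiableOn ℂ g Ω ∧
    (f : ℂ × ℂ → ℂ) =ᵐ[volume.restrict Ω] g}
  add_mem' := by
    rintro f₁ f₂ ⟨g₁, h₁, e₁⟩ ⟨g₂, h₂, e₂⟩
    exact ⟨g₁ + g₂, h₁.add h₂, (Lp.coeFn_add f₁ f₂).trans (e₁.add e₂)⟩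
  zero_mem' := ⟨0, differentiableOn_const 0, Lp.coeFn_zero ℂ 2 _⟩
  smul_mem' := by
    rintro c f ⟨g, h, e⟩
    exact ⟨c • g, h.const_smul c, (Lp.coeFn_smul c f).trans (e.const_smul c)⟩

/-- The Bergman projection, i.e. the orthogonal projection of `L²(Ω)` onto `A²(Ω)`. For open `Ω`
the space `A²(Ω)` is closed in `L²(Ω)`; the closure is written only so that the completeness
needed for an orthogonal projection is available for every set `Ω`. -/
def bergmanProjection (Ω : Set (ℂ × ℂ)) : L2 Ω →L[ℂ] L2 Ω :=
  (bergmanSpace Ω).topologicalClosure.starProjection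

/-- A weight on the Hartogs triangle: an (almost everywhere) positive, locally integrable
function. -/
structure IsWeight (μ : ℂ × ℂ → ℝ) : Prop where
  locallyIntegrableOn : LocallyIntegrableOn μ hartogs volume
  pos : ∀ᵐ w ∂(volume.restrict hartogs), 0 < μ w

/-- The measure `μ dV` on the Hartogs triangle. -/
def weightedMeasure (μ : ℂ × ℂ → ℝ) : Measure (ℂ × ℂ) :=
  (volume.restrict hartogs).withDensity fun w => ENNReal.ofReal (μ w)

/-- `C` bounds the Bergman projection `P` of the Hartogs triangle on `L^p(μ dV)`: one has
`‖P f‖ ≤ C ‖f‖` in `L^p(μ dV)` for every `f ∈ L² ∩ L^p(μ dV)`. -/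
def IsBound (p : ℝ) (μ : ℂ × ℂ → ℝ) (C : ℝ≥0∞) : Prop :=
  ∀ f : L2 hartogs, MemLp f (ENNReal.ofReal p) (weightedMeasure μ) →
    eLpNorm (bergmanProjection hartogs f) (ENNReal.ofReal p) (weightedMeasure μ) ≤
      C * eLpNorm f (ENNReal.ofReal p) (weightedMeasure μ)

/-- The Bergman projection is bounded on `L^p(μ dV)`. -/
def IsBoundedOn (p : ℝ) (μ : ℂ × ℂ → ℝ) : Prop := ∃ C : ℝ≥0, IsBound p μ C

/-- The operator norm `‖P‖` of the Bergman projection on `L^p(μ dV)`, the least bound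
(`∞` if there is no finite one). -/
def projectionNorm (p : ℝ) (μ : ℂ × ℂ → ℝ) : ℝ≥0∞ := sInf {C | IsBound p μ C}

/-- The Carleson tent `T_z`: all of the disc if `z = 0`, and otherwise the points `w` of the
disc with `|1 - w̄ z/|z|| < 1 - |z|`. -/
def carlesonTent (z : ℂ) : Set ℂ :=
  {w | w ∈ disc ∧ (z ≠ 0 → ‖1 - conj w * (z / (‖z‖ : ℂ))‖ < 1 - ‖z‖)}

/-- The induced Carleson tent `T'_{z₁,z₂}` in the Hartogs triangle. -/
def inducedTent (z₁ z₂ : ℂ) : Set (ℂ × ℂ) :=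
  {w | w ∈ hartogs ∧ w.1 / w.2 ∈ carlesonTent z₁ ∧ w.2 ∈ carlesonTent z₂}

/-- The measure `du = |w₂|⁻² dV`. -/
def uMeasure : Measure (ℂ × ℂ) :=
  volume.withDensity fun w => ENNReal.ofReal (‖w.2‖ ^ (-2 : ℝ))

/-- The weight `ν = |w₂|^{-p'} μ^{-p'/p}`, where `p' = p / (p - 1)`. -/
def dualWeight (p : ℝ) (μ : ℂ × ℂ → ℝ) (w : ℂ × ℂ) : ℝ :=
  ‖w.2‖ ^ (-p.conjExponent) * μ w ^ (-p.conjExponent / p)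

/-- The characteristic `[μ, ν]_p`: the supremum over `z₁, z₂` in the disc of
`⟨μ |w₂|^{2-p}⟩ ⟨|w₂|² ν⟩^{p-1}`, with averages over `T'_{z₁,z₂}` with respect to `du`. It takes
values in `[0, ∞]`. -/
def characteristic (p : ℝ) (μ ν : ℂ × ℂ → ℝ) : ℝ≥0∞ :=
  ⨆ z₁ ∈ disc, ⨆ z₂ ∈ disc,
    (⨍⁻ w in inducedTent z₁ z₂, ENNReal.ofReal (μ w * ‖w.2‖ ^ (2 - p)) ∂uMeasure) *
      (⨍⁻ w in inducedTent z₁ z₂, ENNReal.ofReal (‖w.2‖ ^ 2 * ν w) ∂uMeasure) ^ (p - 1)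

end HartogsBergman

end

namespace HartogsBergman

open Complex Set Filter Topology Metric

/-! The coordinates `t = w₁/w₂`, `s = w₂` turn the Hartogs triangle into the disc times the
punctured disc, `du` into Lebesgue measure and induced tents into products of tents. Put `W =
μ|w₂|^{2-p}` and `σ = |w₂|²ν`. Then `σ^{p-1} W = 1`, so `[μ, ν]_p` is a Muckenhoupt characteristic
of `W` over products of tents. Moreover `f ↦ w₂ f` carries `L^p(μ dV)` isometrically into `L^p(W
du)` and conjugates `P` to integration against the bidisc Bergman kernel.

The lower bound comes from testing. Each product tent `T` has a companion `S` with `u(S) ≤ u(T)`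
such that, on `T × S` and on `S × T`, the real part of the bidisc kernel is at least a constant over
`u(S)` (`exists_companion`, `le_re_inv_sq_mul_inv_sq`). Applying `P` to `σ 1_S / w₂` and evaluating
on `T`, and conversely, gives with `N` a bound for `P` `W(T) σ(S)^{p-1} ≤ (c u(S) N)^p` and `W(S)
σ(T)^{p-1} ≤ (c u(S) N)^p` (`setLIntegral_mul_rpow_le`). Multiplying the two and removing the factor
of `S` by Hölder, `u(S)^p ≤ W(S) σ(S)^{p-1}` (`uMeasure_rpow_le`), leaves `W(T) σ(T)^{p-1} ≤ (C
N)^{2p} u(T)^p`. The two tests account for the exponent `2p`. No product structure of the weight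
enters.

Since `P` is defined as an abstract orthogonal projection, its integral kernel has to be derived
(`bergmanProjection_ae_eq`). The reproducing formula is proved on the disc, extended to the
punctured disc and the bidisc, and transported by the change of variables. -/

lemma disc_eq_ball : disc = ball (0 : ℂ) 1 := by
  ext z; simp [disc]

lemma isOpen_disc : IsOpen disc := disc_eq_ball ▸ isOpen_ball

lemma measurableSet_disc : MeasurableSet disc := isOpen_disc.measurableSet

/-! ### The Bergman kernel of the disc. -/

lemma one_sub_mul_conj_ne_zero {a t : ℂ} (ha : a ∈ disc) (ht : t ∈ disc) :
    1 - a * conj t ≠ 0 := by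
  intro h
  have h1 : a * conj t = 1 := (sub_eq_zero.1 h).symm
  have h2 : ‖a‖ * ‖t‖ = 1 := by simpa using congrArg norm h1
  have ha' : ‖a‖ < 1 := ha
  have ht' : ‖t‖ < 1 := ht
  nlinarith [norm_nonneg a, norm_nonneg t]

lemma one_sub_le_norm_one_sub_mul_conj {a t : ℂ} (ht : t ∈ disc) :
    1 - ‖a‖ ≤ ‖1 - a * conj t‖ := by
  have ht' : ‖t‖ < 1 := ht
  have h := norm_sub_norm_le (1 : ℂ) (a * conj t)
  simp only [norm_one, norm_mul, RCLike.norm_conj] at h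
  nlinarith [norm_nonneg a]

lemma norm_inv_one_sub_sq_le {a t : ℂ} (ha : a ∈ disc) (ht : t ∈ disc) :
    ‖((1 - a * conj t) ^ 2)⁻¹‖ ≤ ((1 - ‖a‖) ^ 2)⁻¹ := by
  have ha' : ‖a‖ < 1 := ha
  rw [norm_inv, norm_pow]
  have := one_sub_le_norm_one_sub_mul_conj (a := a) ht
  have h0 : 0 < 1 - ‖a‖ := by linarith
  gcongr

lemma continuousOn_bergmanKernel {a : ℂ} (ha : a ∈ disc) :
    ContinuousOn (fun t : ℂ => ((1 - a * conj t) ^ 2)⁻¹) disc := by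
  have h : Continuous fun t : ℂ => (1 - a * conj t) ^ 2 := by fun_prop
  exact h.continuousOn.inv₀ fun t ht => pow_ne_zero 2 (one_sub_mul_conj_ne_zero ha ht)

lemma IntegrableOn.mul_bergmanKernel {g : ℂ → ℂ} (hi : IntegrableOn g disc) {a : ℂ}
    (ha : a ∈ disc) : IntegrableOn (fun t => g t * ((1 - a * conj t) ^ 2)⁻¹) disc := by
  refine Integrable.mul_bdd (c := ((1 - ‖a‖) ^ 2)⁻¹) hi
    ((continuousOn_bergmanKernel ha).aestronglyMeasurable measurableSet_disc) ?_
  filter_upwards [ae_restrict_mem measurableSet_disc] with t ht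
  exact norm_inv_one_sub_sq_le ha ht

/-- On `|t| = r` one has `t̄ = r²/t`, hence `1 - a t̄ = (t - a r²)/t`. The integral is therefore
Cauchy's formula for the derivative of `t g(t)` at `a r²`. -/
lemma integral_circle_mul_bergmanKernel {g : ℂ → ℂ} (hg : DifferentiableOn ℂ g disc) {a : ℂ}
    (ha : a ∈ disc) {r : ℝ} (hr : 0 < r) (hr1 : r < 1) :
    ∫ θ in Ioo (-Real.pi) Real.pi, g (circleMap 0 r θ) *
      ((1 - a * conj (circleMap 0 r θ)) ^ 2)⁻¹ =
      2 * Real.pi * deriv (fun t => t * g t) (a * r ^ 2) := by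
  have ha' : ‖a‖ < 1 := ha
  have hF : DifferentiableOn ℂ (fun t => t * g t) disc := differentiableOn_id.mul hg
  have hsub : closedBall (0 : ℂ) r ⊆ disc := by
    rw [disc_eq_ball]; exact closedBall_subset_ball hr1
  have hw : a * (r : ℂ) ^ 2 ∈ ball (0 : ℂ) r := by
    simp only [mem_ball_zero_iff, norm_mul, norm_pow, norm_real, Real.norm_eq_abs, abs_of_pos hr]
    nlinarith [norm_nonneg a, mul_pos hr hr]
  have key := two_pi_I_inv_smul_circleIntegral_sub_sq_inv_smul_of_differentiable isOpen_disc hsub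
    hF hw
  have hper : Function.Periodic (fun θ : ℝ => g (circleMap 0 r θ) *
      ((1 - a * conj (circleMap 0 r θ)) ^ 2)⁻¹) (2 * Real.pi) := by
    intro θ
    simp only [periodic_circleMap 0 r θ]
  rw [← integral_Ioc_eq_integral_Ioo, ← intervalIntegral.integral_of_le (by linarith [Real.pi_pos])]
  have hs := hper.intervalIntegral_add_eq (-Real.pi) 0
  rw [show -Real.pi + 2 * Real.pi = Real.pi by ring, zero_add] at hs
  rw [hs, ← key, circleIntegral]
  have hint : ∀ θ : ℝ, deriv (circleMap 0 r) θ • (((circleMap 0 r θ - a * r ^ 2) ^ 2)⁻¹ •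
      (circleMap 0 r θ * g (circleMap 0 r θ))) =
      I * (g (circleMap 0 r θ) * ((1 - a * conj (circleMap 0 r θ)) ^ 2)⁻¹) := by
    intro θ
    set t := circleMap 0 r θ with ht
    have htn : ‖t‖ = r := by simp [ht, abs_of_pos hr]
    have ht0 : t ≠ 0 := by
      rw [← norm_pos_iff, htn]; exact hr
    have htt : t * conj t = (r : ℂ) ^ 2 := by
      rw [mul_conj, normSq_eq_norm_sq, htn]; push_cast; ring
    have h1 : t - a * r ^ 2 = t * (1 - a * conj t) := by rw [← htt]; ring
    have htd : t ∈ disc := by change ‖t‖ < 1; rw [htn]; exact hr1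
    have hne := one_sub_mul_conj_ne_zero ha htd
    rw [h1]
    simp only [deriv_circleMap, smul_eq_mul, ← ht]
    field_simp
  rw [intervalIntegral.integral_congr (fun θ _ => hint θ), intervalIntegral.integral_const_mul]
  have hpi : (Real.pi : ℂ) ≠ 0 := by exact_mod_cast Real.pi_ne_zero
  simp only [smul_eq_mul]
  field_simp

/-- The reproducing property of the Bergman kernel of the disc for integrable holomorphic
functions. -/
theorem integral_disc_mul_bergmanKernel {g : ℂ → ℂ} (hg : DifferentiableOn ℂ g disc)
    (hi : IntegrableOn g disc) {a : ℂ} (ha : a ∈ disc) :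
    ∫ t in disc, g t * ((1 - a * conj t) ^ 2)⁻¹ = Real.pi * g a := by
  classical
  have ha' : ‖a‖ < 1 := ha
  set f : ℂ → ℂ := disc.piecewise (fun t => g t * ((1 - a * conj t) ^ 2)⁻¹) (fun _ => 0) with hf
  have hfi : f = disc.indicator (fun t => g t * ((1 - a * conj t) ^ 2)⁻¹) := by
    rw [hf]; exact piecewise_eq_indicator
  have hfm : Measurable f :=
    (hg.continuousOn.mul (continuousOn_bergmanKernel ha)).measurable_piecewise
      continuousOn_const measurableSet_disc
  have hfint : Integrable f := by
    rw [hfi, integrable_indicator_iff measurableSet_disc]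
    exact IntegrableOn.mul_bergmanKernel hi ha
  have hcm : ∀ p : ℝ × ℝ, Complex.polarCoord.symm p = circleMap 0 p.1 p.2 := by
    intro p
    simp [circleMap, exp_mul_I]
  have htm : MeasurableSet polarCoord.target := polarCoord.open_target.measurableSet
  have hpint : IntegrableOn (fun p : ℝ × ℝ => p.1 • f (circleMap 0 p.1 p.2)) polarCoord.target := by
    refine ⟨?_, ?_⟩
    · refine (Measurable.aestronglyMeasurable ?_)
      refine measurable_fst.smul (hfm.comp ?_)
      have : Continuous fun p : ℝ × ℝ => circleMap 0 p.1 p.2 := by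
        unfold circleMap; fun_prop
      exact this.measurable
    · have h1 := Complex.lintegral_comp_polarCoord_symm (fun t => ‖f t‖ₑ)
      have h2 : ∫⁻ t, ‖f t‖ₑ < ∞ := hfint.2
      rw [HasFiniteIntegral]
      rw [← h1] at h2
      refine lt_of_le_of_lt (le_of_eq ?_) h2
      refine setLIntegral_congr_fun htm fun p hp => ?_
      have hp1 : 0 < p.1 := hp.1
      simp only [hcm, enorm_smul, smul_eq_mul, Real.enorm_eq_ofReal hp1.le]
  rw [← integral_indicator measurableSet_disc, ← hfi, ← Complex.integral_comp_polarCoord_symm]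
  simp only [hcm]
  rw [polarCoord_target, Measure.volume_eq_prod, setIntegral_prod _ (by
    rw [polarCoord_target] at hpint; exact hpint)]
  have hin : ∀ r : ℝ, 0 < r → ∫ θ in Ioo (-Real.pi) Real.pi, r • f (circleMap 0 r θ) =
      (Ioo (0 : ℝ) 1).indicator
        (fun r => (Real.pi : ℂ) * (2 * r * deriv (fun t => t * g t) (a * r ^ 2))) r := by
    intro r hr
    have hn : ∀ θ : ℝ, ‖circleMap 0 r θ‖ = r := fun θ => by simp [abs_of_pos hr]
    by_cases hr1 : r < 1
    · have hm : ∀ θ : ℝ, circleMap 0 r θ ∈ disc := fun θ => by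
        change ‖_‖ < 1; rw [hn]; exact hr1
      rw [indicator_of_mem (show r ∈ Ioo (0 : ℝ) 1 from ⟨hr, hr1⟩), integral_smul]
      simp only [hfi, indicator_of_mem (hm _)]
      rw [integral_circle_mul_bergmanKernel hg ha hr hr1, real_smul]
      ring
    · have hm : ∀ θ : ℝ, circleMap 0 r θ ∉ disc := fun θ => by
        change ¬ ‖_‖ < 1; rw [hn]; exact hr1
      rw [indicator_of_notMem (show r ∉ Ioo (0 : ℝ) 1 from fun h => hr1 h.2)]
      simp only [hfi, indicator_of_notMem (hm _), smul_zero, integral_zero]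
  rw [setIntegral_congr_fun measurableSet_Ioi (fun r hr => hin r hr),
    setIntegral_indicator measurableSet_Ioo,
    inter_eq_self_of_subset_right Ioo_subset_Ioi_self,
    ← integral_Ioc_eq_integral_Ioo, ← intervalIntegral.integral_of_le zero_le_one,
    intervalIntegral.integral_const_mul]
  congr 1
  have hmem : ∀ r ∈ uIcc (0 : ℝ) 1, a * (r : ℂ) ^ 2 ∈ disc := by
    intro r hr
    rw [uIcc_of_le zero_le_one] at hr
    change ‖_‖ < 1
    simp only [norm_mul, norm_pow, norm_real, Real.norm_eq_abs, sq_abs]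
    have : r ^ 2 ≤ 1 := by nlinarith [hr.1, hr.2]
    nlinarith [norm_nonneg a, sq_nonneg r]
  have hF : DifferentiableOn ℂ (fun t => t * g t) disc := differentiableOn_id.mul hg
  -- The radial integrand has primitive `r² g(a r²)`, a form that also covers `a = 0`. Since `a r²`
  -- stays in the open disc up to `r = 1`, no boundary values of `g` are needed.
  have hd : ∀ r ∈ uIcc (0 : ℝ) 1, HasDerivAt (fun r : ℝ => (r : ℂ) ^ 2 * g (a * (r : ℂ) ^ 2))
      (2 * r * deriv (fun t => t * g t) (a * r ^ 2)) r := by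
    intro r hr
    have hga := (hg.differentiableAt (isOpen_disc.mem_nhds (hmem r hr))).hasDerivAt
    have hFd : deriv (fun t => t * g t) (a * (r : ℂ) ^ 2) =
        1 * g (a * r ^ 2) + a * r ^ 2 * deriv g (a * r ^ 2) :=
      ((hasDerivAt_id (a * (r : ℂ) ^ 2)).mul hga).deriv
    have hsq : HasDerivAt (fun z : ℂ => z ^ 2) (2 * (r : ℂ)) (r : ℂ) := by
      simpa using hasDerivAt_pow 2 (r : ℂ)
    have hc : HasDerivAt (fun z : ℂ => z ^ 2 * g (a * z ^ 2))
        (2 * (r : ℂ) * g (a * r ^ 2) + r ^ 2 * (deriv g (a * r ^ 2) * (a * (2 * r)))) (r : ℂ) :=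
      hsq.mul (HasDerivAt.comp (r : ℂ) hga (hsq.const_mul a))
    have := hc.comp_ofReal
    rw [hFd]
    convert this using 1
    ring
  have hcont : ContinuousOn (fun r : ℝ => 2 * (r : ℂ) * deriv (fun t => t * g t) (a * r ^ 2))
      (uIcc 0 1) := by
    refine ContinuousOn.mul (by fun_prop) ?_
    exact (hF.deriv isOpen_disc).continuousOn.comp (by fun_prop) hmem
  rw [intervalIntegral.integral_eq_sub_of_hasDerivAt hd hcont.intervalIntegrable]
  simp

/-! ### Square integrable holomorphic functions on the punctured disc and the bidisc. -/

lemma integral_ball_eq_of_differentiableOn {g : ℂ → ℂ} {c : ℂ} {R : ℝ} (hR : 0 < R)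
    (hg : DifferentiableOn ℂ g (ball c R)) (hi : IntegrableOn g (ball c R)) :
    ∫ t in ball c R, g t = Real.pi * R ^ 2 * g c := by
  have hmaps : ∀ t : ℂ, c + R • t ∈ ball c R ↔ t ∈ disc := by
    intro t
    simp only [mem_ball, dist_eq_norm, add_sub_cancel_left, norm_smul, Real.norm_eq_abs,
      abs_of_pos hR, disc, mem_ofPred_eq]
    exact mul_lt_iff_lt_one_right hR
  have hind : ∀ t, (ball c R).indicator g (c + R • t) =
      disc.indicator (fun t => g (c + R • t)) t := by
    intro t
    by_cases ht : t ∈ disc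
    · rw [indicator_of_mem ht, indicator_of_mem ((hmaps t).2 ht)]
    · rw [indicator_of_notMem ht, indicator_of_notMem (fun h => ht ((hmaps t).1 h))]
  have hint : Integrable ((ball c R).indicator g) := hi.integrable_indicator measurableSet_ball
  have hdisc : IntegrableOn (fun t => g (c + R • t)) disc := by
    rw [← integrable_indicator_iff measurableSet_disc]
    have h1 : Integrable (fun t => (ball c R).indicator g (c + R • t)) :=
      (hint.comp_add_left c).comp_smul hR.ne'
    exact h1.congr (Eventually.of_forall hind)
  have hd : DifferentiableOn ℂ (fun t => g (c + R • t)) disc := by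
    refine hg.comp ?_ fun t ht => (hmaps t).2 ht
    have : Differentiable ℂ fun t : ℂ => c + (R : ℂ) * t := by fun_prop
    simpa [real_smul] using this.differentiableOn
  have h := integral_disc_mul_bergmanKernel hd hdisc (a := 0) (by simp [disc])
  simp only [zero_mul, sub_zero, one_pow, inv_one, mul_one, smul_zero, add_zero] at h
  have h2 := Measure.integral_comp_smul volume (fun t => (ball c R).indicator g (c + t)) R
  rw [integral_add_left_eq_self (fun t => (ball c R).indicator g t) c,
    integral_indicator measurableSet_ball] at h2
  simp only [hind] at h2
  rw [integral_indicator measurableSet_disc, h, Complex.finrank_real_complex, abs_of_pos (by positivity), real_smul]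
    at h2
  have hR' : (R : ℂ) ≠ 0 := by exact_mod_cast hR.ne'
  push_cast at h2
  field_simp at h2
  linear_combination -h2

/-- This growth makes the singularity at `0` removable. The mean value property on the ball of
radius `|c|/2` about `c` bounds `g c`, and the integral of `|g|²` over that ball tends to `0` with
its area. -/
lemma isLittleO_inv_of_integrableOn_sq {g : ℂ → ℂ} (hg : DifferentiableOn ℂ g (disc \ {0}))
    (hi : IntegrableOn (fun t => ‖g t‖ ^ 2) disc) :
    g =o[𝓝[≠] 0] fun z => (z - 0)⁻¹ := by
  have hvol : Tendsto (fun c : ℂ => (volume.restrict disc) (ball c (‖c‖ / 2))) (𝓝 0) (𝓝 0) := by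
    have h1 : Tendsto (fun c : ℂ => ENNReal.ofReal (‖c‖ / 2) ^ 2 * (NNReal.pi : ℝ≥0∞)) (𝓝 0)
        (𝓝 (ENNReal.ofReal (‖(0 : ℂ)‖ / 2) ^ 2 * (NNReal.pi : ℝ≥0∞))) := by
      refine ENNReal.Tendsto.mul_const ?_ (Or.inr ENNReal.coe_ne_top)
      refine ENNReal.Tendsto.pow (ENNReal.tendsto_ofReal ?_)
      exact (continuous_norm.div_const 2).tendsto 0
    simp only [norm_zero, zero_div, ENNReal.ofReal_zero, ne_eq, OfNat.ofNat_ne_zero,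
      not_false_eq_true, zero_pow, zero_mul] at h1
    refine tendsto_of_tendsto_of_tendsto_of_le_of_le tendsto_const_nhds h1 (fun _ => zero_le)
      fun c => ?_
    rw [← Complex.volume_ball]
    exact Measure.restrict_apply_le _ _
  have hI := Integrable.tendsto_setIntegral_nhds_zero hi hvol
  rw [Asymptotics.isLittleO_iff]
  intro ε hε
  have e1 := hI.eventually (gt_mem_nhds (show (0 : ℝ) < ε ^ 2 / 2 by positivity))
  have e2 : ∀ᶠ c : ℂ in 𝓝 0, c ∈ ball (0 : ℂ) (1 / 2) := ball_mem_nhds _ (by norm_num)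
  filter_upwards [self_mem_nhdsWithin, nhdsWithin_le_nhds e1, nhdsWithin_le_nhds e2] with c hc0 h1 h2
  have hc0 : c ≠ 0 := hc0
  have hcp : 0 < ‖c‖ := norm_pos_iff.2 hc0
  rw [mem_ball_zero_iff] at h2
  have hsub : ball c (‖c‖ / 2) ⊆ disc \ {0} := by
    intro t ht
    rw [mem_ball, dist_eq_norm] at ht
    refine ⟨?_, ?_⟩
    · have := norm_le_norm_add_norm_sub c t
      rw [norm_sub_rev] at this
      change ‖t‖ < 1; linarith
    · rintro rfl
      rw [zero_sub, norm_neg] at ht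
      linarith
  have hsub' : ball c (‖c‖ / 2) ⊆ disc := fun t ht => (hsub ht).1
  have hgb := hg.mono hsub
  have hib : IntegrableOn (fun t => ‖g t‖ ^ 2) (ball c (‖c‖ / 2)) := hi.mono_set hsub'
  have hc1 : IntegrableOn (fun _ : ℂ => ε / (2 * ‖c‖)) (ball c (‖c‖ / 2)) :=
    integrableOn_const measure_ball_lt_top.ne
  have hmaj : IntegrableOn (fun t => ε / (2 * ‖c‖) + ‖c‖ / (2 * ε) * ‖g t‖ ^ 2)
      (ball c (‖c‖ / 2)) := hc1.add (hib.const_mul _)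
  -- Weighted AM-GM in place of Cauchy–Schwarz; it also yields integrability of `g`.
  have hpt : ∀ t, ‖g t‖ ≤ ε / (2 * ‖c‖) + ‖c‖ / (2 * ε) * ‖g t‖ ^ 2 := by
    intro t
    have : ε / (2 * ‖c‖) + ‖c‖ / (2 * ε) * ‖g t‖ ^ 2 - ‖g t‖ =
        (ε - ‖c‖ * ‖g t‖) ^ 2 / (2 * ‖c‖ * ε) := by
      field_simp
      ring
    have h3 : 0 ≤ (ε - ‖c‖ * ‖g t‖) ^ 2 / (2 * ‖c‖ * ε) := by positivity
    linarith
  have hgi : IntegrableOn g (ball c (‖c‖ / 2)) :=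
    hmaj.mono' (hgb.continuousOn.aestronglyMeasurable measurableSet_ball)
      (Eventually.of_forall hpt)
  have hmv := integral_ball_eq_of_differentiableOn (half_pos hcp) hgb hgi
  have hle : ‖∫ t in ball c (‖c‖ / 2), g t‖ ≤
      ∫ t in ball c (‖c‖ / 2), (ε / (2 * ‖c‖) + ‖c‖ / (2 * ε) * ‖g t‖ ^ 2) :=
    norm_integral_le_of_norm_le hmaj (Eventually.of_forall hpt)
  have hvr : (volume : Measure ℂ).real (ball c (‖c‖ / 2)) = Real.pi * (‖c‖ / 2) ^ 2 := by
    rw [Measure.real, Complex.volume_ball, ENNReal.toReal_mul, ENNReal.toReal_pow,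
      ENNReal.toReal_ofReal (by positivity), ENNReal.coe_toReal, NNReal.coe_real_pi]
    ring
  rw [Measure.restrict_restrict_of_subset hsub'] at h1
  rw [integral_add hc1 (hib.const_mul _), setIntegral_const, integral_const_mul, hmv, hvr] at hle
  simp only [norm_mul, norm_pow, norm_real, Real.norm_eq_abs, abs_of_pos Real.pi_pos,
    smul_eq_mul, ofReal_div, norm_div] at hle
  rw [sub_zero, norm_inv, ← div_eq_mul_inv, le_div_iff₀ hcp]
  have hpi := Real.pi_gt_three
  norm_num at hle
  have h5 : ‖c‖ / (2 * ε) * ∫ t in ball c (‖c‖ / 2), ‖g t‖ ^ 2 ≤ ‖c‖ / (2 * ε) * (ε ^ 2 / 2) := by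
    gcongr
  have h6 : Real.pi * (‖c‖ / 2) ^ 2 * ‖g c‖ ≤
      Real.pi * (‖c‖ / 2) ^ 2 * (ε / (2 * ‖c‖)) + ‖c‖ / (2 * ε) * (ε ^ 2 / 2) := by
    linarith
  have h7 : Real.pi * (‖c‖ / 2) ^ 2 * (ε / (2 * ‖c‖)) + ‖c‖ / (2 * ε) * (ε ^ 2 / 2) =
      ‖c‖ / 4 * (Real.pi * ε / 2 + ε) := by
    field_simp
    norm_num
  rw [h7, show Real.pi * (‖c‖ / 2) ^ 2 * ‖g c‖ = ‖c‖ / 4 * (Real.pi * (‖g c‖ * ‖c‖)) by ring] at h6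
  have h8 := le_of_mul_le_mul_left h6 (by positivity)
  have h9 : Real.pi * (‖g c‖ * ‖c‖) ≤ Real.pi * ε := by nlinarith
  exact le_of_mul_le_mul_left h9 Real.pi_pos

/-- The reproducing property for square integrable holomorphic functions on the punctured disc. -/
theorem integral_puncturedDisc_mul_bergmanKernel {g : ℂ → ℂ}
    (hg : DifferentiableOn ℂ g (disc \ {0})) (hi : IntegrableOn g disc)
    (hi2 : IntegrableOn (fun t => ‖g t‖ ^ 2) disc) {a : ℂ} (ha : a ∈ disc) (ha0 : a ≠ 0) :
    ∫ t in disc, g t * ((1 - a * conj t) ^ 2)⁻¹ = Real.pi * g a := by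
  -- The removable singularity theorem is stated for `g - g 0`; the value `g 0` is arbitrary here,
  -- and a constant is harmless.
  have hconst : (fun _ : ℂ => g 0) =o[𝓝[≠] 0] fun z : ℂ => (z - 0)⁻¹ := by
    refine Asymptotics.isLittleO_const_left.2 (Or.inr ?_)
    simpa [Function.comp_def] using (tendsto_norm_inv_nhdsNE_zero_atTop (α := ℂ))
  have hd := differentiableOn_update_limUnder_of_isLittleO
    (isOpen_disc.mem_nhds (by simp [disc] : (0 : ℂ) ∈ disc)) hg
    ((isLittleO_inv_of_integrableOn_sq hg hi2).sub hconst)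
  set G := Function.update g 0 (limUnder (𝓝[≠] 0) g) with hG
  have hae : g =ᵐ[volume.restrict disc] G := by
    have : ∀ᵐ t : ℂ ∂(volume.restrict disc), t ≠ 0 :=
      ae_restrict_of_ae (Measure.ae_ne volume 0)
    filter_upwards [this] with t ht
    rw [hG, Function.update_of_ne ht]
  have h := integral_disc_mul_bergmanKernel hd (hi.congr hae) ha
  rw [hG, Function.update_of_ne ha0, ← hG] at h
  rw [← h]
  refine integral_congr_ae ?_
  filter_upwards [hae] with t ht
  rw [ht]

/-- The reproducing property of the Bergman kernel of the bidisc for square integrable functions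
holomorphic off the second coordinate axis. -/
theorem integral_bidisc_mul_bergmanKernel {G : ℂ × ℂ → ℂ}
    (hG : DifferentiableOn ℂ G (disc ×ˢ (disc \ {0})))
    (hi : IntegrableOn G (disc ×ˢ disc)) (hi2 : IntegrableOn (fun q => ‖G q‖ ^ 2) (disc ×ˢ disc))
    {a b : ℂ} (ha : a ∈ disc) (hb : b ∈ disc) (hb0 : b ≠ 0) :
    ∫ q in disc ×ˢ disc, G q * (((1 - a * conj q.1) ^ 2)⁻¹ * ((1 - b * conj q.2) ^ 2)⁻¹) =
      Real.pi ^ 2 * G (a, b) := by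
  have hslice1 : ∀ t ∈ disc, DifferentiableOn ℂ (fun s => G (t, s)) (disc \ {0}) := fun t ht =>
    hG.comp (by fun_prop) fun s hs => ⟨ht, hs⟩
  have hslice2 : DifferentiableOn ℂ (fun t => G (t, b)) disc :=
    hG.comp (by fun_prop) fun t ht => ⟨ht, hb, hb0⟩
  have hmeas : MeasurableSet (disc ×ˢ disc) := measurableSet_disc.prod measurableSet_disc
  have hker : IntegrableOn (fun q : ℂ × ℂ =>
      G q * (((1 - a * conj q.1) ^ 2)⁻¹ * ((1 - b * conj q.2) ^ 2)⁻¹)) (disc ×ˢ disc) := by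
    refine Integrable.mul_bdd (c := ((1 - ‖a‖) ^ 2)⁻¹ * ((1 - ‖b‖) ^ 2)⁻¹) hi ?_ ?_
    · refine ContinuousOn.aestronglyMeasurable ?_ hmeas
      exact ((continuousOn_bergmanKernel ha).comp continuousOn_fst fun q hq => hq.1).mul
        ((continuousOn_bergmanKernel hb).comp continuousOn_snd fun q hq => hq.2)
    · filter_upwards [ae_restrict_mem hmeas] with q hq
      rw [norm_mul]
      exact mul_le_mul (norm_inv_one_sub_sq_le ha hq.1) (norm_inv_one_sub_sq_le hb hq.2)
        (norm_nonneg _) (by positivity)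
  have hinner : ∀ᵐ t ∂(volume.restrict disc), ∫ s in disc,
      G (t, s) * (((1 - a * conj t) ^ 2)⁻¹ * ((1 - b * conj s) ^ 2)⁻¹) =
      Real.pi * (G (t, b) * ((1 - a * conj t) ^ 2)⁻¹) := by
    have hi' := hi
    have hi2' := hi2
    rw [IntegrableOn, Measure.volume_eq_prod, ← Measure.prod_restrict] at hi' hi2'
    filter_upwards [hi'.prod_right_ae, hi2'.prod_right_ae, ae_restrict_mem measurableSet_disc]
      with t h1 h2 ht
    have := integral_puncturedDisc_mul_bergmanKernel (hslice1 t ht) h1 h2 hb hb0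
    calc _ = ∫ s in disc, ((1 - a * conj t) ^ 2)⁻¹ * (G (t, s) * ((1 - b * conj s) ^ 2)⁻¹) := by
          congr 1; ext s; ring
      _ = _ := by rw [integral_const_mul, this]; ring
  have hpi : (Real.pi : ℂ) ≠ 0 := by exact_mod_cast Real.pi_ne_zero
  -- Fubini says nothing about the single slice at height `b`. Its integrability is read off from
  -- the inner integral, a multiple of `G(t, b)(1 - a t̄)⁻²` that Fubini shows integrable, after
  -- multiplication by the bounded `(1 - a t̄)²`.
  have houter : IntegrableOn (fun t => G (t, b)) disc := by
    have hker' := hker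
    rw [IntegrableOn, Measure.volume_eq_prod, ← Measure.prod_restrict] at hker'
    have h1 : Integrable (fun t => (Real.pi : ℂ) * (G (t, b) * ((1 - a * conj t) ^ 2)⁻¹))
        (volume.restrict disc) := hker'.integral_prod_left.congr hinner
    have h2 := Integrable.mul_bdd (c := (Real.pi)⁻¹ * 4) h1
      (g := fun t => (Real.pi : ℂ)⁻¹ * (1 - a * conj t) ^ 2) (by fun_prop) (by
        filter_upwards [ae_restrict_mem measurableSet_disc] with t ht
        have ha' : ‖a‖ < 1 := ha
        have ht' : ‖t‖ < 1 := ht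
        rw [norm_mul, norm_inv, norm_pow, norm_real, Real.norm_eq_abs, abs_of_pos Real.pi_pos]
        have h3 : ‖1 - a * conj t‖ ≤ 2 := by
          refine (norm_sub_le _ _).trans ?_
          rw [norm_one, norm_mul, RCLike.norm_conj]
          nlinarith [norm_nonneg a, norm_nonneg t]
        have h4 : ‖1 - a * conj t‖ ^ 2 ≤ 4 := by nlinarith [norm_nonneg (1 - a * conj t)]
        gcongr)
    refine h2.congr ?_
    filter_upwards [ae_restrict_mem measurableSet_disc] with t ht
    have := one_sub_mul_conj_ne_zero ha ht
    field_simp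
  rw [Measure.volume_eq_prod, setIntegral_prod _ hker, integral_congr_ae hinner,
    integral_const_mul, integral_disc_mul_bergmanKernel hslice2 houter ha]
  ring

/-! ### Change of variables from the bidisc to the Hartogs triangle. -/

/-- The map `(t, s) ↦ (t s, s)` of the product of the disc with the punctured disc onto the
Hartogs triangle. -/
def bidiscMap (q : ℂ × ℂ) : ℂ × ℂ := (q.1 * q.2, q.2)

lemma continuous_bidiscMap : Continuous bidiscMap := by unfold bidiscMap; fun_prop

lemma isOpen_hartogs : IsOpen hartogs := by
  have h1 : IsOpen {z : ℂ × ℂ | ‖z.1‖ < ‖z.2‖} := isOpen_lt (by fun_prop) (by fun_prop)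
  have h2 : IsOpen {z : ℂ × ℂ | ‖z.2‖ < 1} := isOpen_lt (by fun_prop) (by fun_prop)
  exact h1.inter h2

lemma measurableSet_hartogs : MeasurableSet hartogs := isOpen_hartogs.measurableSet

lemma snd_ne_zero_of_mem_hartogs {w : ℂ × ℂ} (hw : w ∈ hartogs) : w.2 ≠ 0 := by
  rw [← norm_pos_iff]
  exact (norm_nonneg _).trans_lt hw.1

lemma div_mem_disc_of_mem_hartogs {w : ℂ × ℂ} (hw : w ∈ hartogs) : w.1 / w.2 ∈ disc := by
  change ‖_‖ < 1
  rw [norm_div, div_lt_one (norm_pos_iff.2 (snd_ne_zero_of_mem_hartogs hw))]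
  exact hw.1

lemma bidiscMap_mem_hartogs_iff {q : ℂ × ℂ} (h : q.2 ≠ 0) :
    bidiscMap q ∈ hartogs ↔ q ∈ disc ×ˢ disc := by
  have : 0 < ‖q.2‖ := norm_pos_iff.2 h
  change (‖q.1 * q.2‖ < ‖q.2‖ ∧ ‖q.2‖ < 1) ↔ (‖q.1‖ < 1 ∧ ‖q.2‖ < 1)
  rw [norm_mul, mul_lt_iff_lt_one_left this]

lemma volume_preimage_mul_right {c : ℂ} (hc : c ≠ 0) (s : Set ℂ) :
    volume ((fun t : ℂ => t * c) ⁻¹' s) = ENNReal.ofReal (‖c‖ ^ (-2 : ℝ)) * volume s := by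
  have hdet : LinearMap.det (LinearMap.mulLeft ℝ c) = ‖c‖ ^ 2 := by
    have := Algebra.norm_complex_apply c
    rw [Algebra.norm_apply, normSq_eq_norm_sq] at this
    exact this
  have h := Measure.addHaar_preimage_linearMap (volume : Measure ℂ) (f := LinearMap.mulLeft ℝ c)
    (by rw [hdet]; positivity) s
  rw [hdet] at h
  have hf : (fun t : ℂ => t * c) = (LinearMap.mulLeft ℝ c) := by
    ext t; simp [mul_comm]
  rw [hf, h, abs_of_nonneg (by positivity), Real.rpow_neg (norm_nonneg _)]
  norm_cast

lemma measurable_density : Measurable fun w : ℂ × ℂ => ENNReal.ofReal (‖w.2‖ ^ (-2 : ℝ)) := by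
  fun_prop

/-- Slicing at fixed `s ≠ 0`, the map `t ↦ t s` scales area by `|s|²`, which the density `|s|⁻²` of
`u` cancels. The slice `s = 0` is null. -/
theorem measurePreserving_bidiscMap :
    MeasurePreserving bidiscMap (volume.restrict (disc ×ˢ disc)) (uMeasure.restrict hartogs) := by
  refine ⟨continuous_bidiscMap.measurable, ?_⟩
  ext A hA
  have hDD : MeasurableSet (disc ×ˢ disc) := measurableSet_disc.prod measurableSet_disc
  have hAH : MeasurableSet (A ∩ hartogs) := hA.inter measurableSet_hartogs
  rw [Measure.map_apply continuous_bidiscMap.measurable hA,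
    Measure.restrict_apply (continuous_bidiscMap.measurable hA), Measure.restrict_apply hA,
    uMeasure, withDensity_apply _ hAH, ← lintegral_indicator hAH, Measure.volume_eq_prod,
    Measure.prod_apply_symm ((continuous_bidiscMap.measurable hA).inter hDD),
    lintegral_prod_symm' _ (measurable_density.indicator hAH)]
  refine lintegral_congr_ae ?_
  filter_upwards [Measure.ae_ne volume (0 : ℂ)] with s hs
  have h1 : ∀ x : ℂ, (A ∩ hartogs).indicator
      (fun w : ℂ × ℂ => ENNReal.ofReal (‖w.2‖ ^ (-2 : ℝ))) (x, s) =
      ((fun x => (x, s)) ⁻¹' (A ∩ hartogs)).indicator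
        (fun _ => ENNReal.ofReal (‖s‖ ^ (-2 : ℝ))) x := fun x => rfl
  simp only [h1]
  rw [lintegral_indicator_const (measurable_prodMk_right hAH), ← volume_preimage_mul_right hs]
  congr 1
  ext t
  have := bidiscMap_mem_hartogs_iff (q := (t, s)) hs
  simp only [mem_preimage, mem_inter_iff, ← this]
  rfl

lemma volume_restrict_hartogs :
    volume.restrict hartogs =
      (uMeasure.restrict hartogs).withDensity fun w => ENNReal.ofReal (‖w.2‖ ^ 2) := by
  rw [uMeasure, restrict_withDensity measurableSet_hartogs,
    ← withDensity_mul _ measurable_density (by fun_prop)]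
  nth_rw 1 [← withDensity_one (μ := volume.restrict hartogs)]
  refine withDensity_congr_ae ?_
  filter_upwards [ae_restrict_mem measurableSet_hartogs] with w hw
  have : 0 < ‖w.2‖ := norm_pos_iff.2 (snd_ne_zero_of_mem_hartogs hw)
  rw [Pi.mul_apply, ← ENNReal.ofReal_mul (by positivity), Real.rpow_neg (norm_nonneg _)]
  norm_cast
  rw [inv_mul_cancel₀ (by positivity), Pi.one_apply, ENNReal.ofReal_one]

lemma lintegral_hartogs (F : ℂ × ℂ → ℝ≥0∞) :
    ∫⁻ w in hartogs, F w = ∫⁻ w in hartogs, ENNReal.ofReal (‖w.2‖ ^ 2) * F w ∂uMeasure := by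
  rw [volume_restrict_hartogs, lintegral_withDensity_eq_lintegral_mul_non_measurable _ (by fun_prop)
    (Eventually.of_forall fun _ => ENNReal.ofReal_lt_top)]
  rfl

lemma integral_hartogs (F : ℂ × ℂ → ℂ) :
    ∫ w in hartogs, F w = ∫ w in hartogs, (‖w.2‖ ^ 2 : ℝ) • F w ∂uMeasure := by
  rw [volume_restrict_hartogs, integral_withDensity_eq_integral_toReal_smul (by fun_prop)
    (Eventually.of_forall fun _ => ENNReal.ofReal_lt_top)]
  simp only [ENNReal.toReal_ofReal (sq_nonneg _)]

lemma integrableOn_hartogs_iff {E : Type*} [NormedAddCommGroup E] [NormedSpace ℝ E]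
    {F : ℂ × ℂ → E} : IntegrableOn F hartogs ↔
      IntegrableOn (fun w => (‖w.2‖ ^ 2 : ℝ) • F w) hartogs uMeasure := by
  rw [IntegrableOn, volume_restrict_hartogs, integrable_withDensity_iff_integrable_smul'
    (by fun_prop) (Eventually.of_forall fun _ => ENNReal.ofReal_lt_top)]
  simp only [ENNReal.toReal_ofReal (sq_nonneg _)]
  rfl

/-- The subset of the Hartogs triangle that corresponds to `A × B` in the bidisc. -/
def hartogsProd (A B : Set ℂ) : Set (ℂ × ℂ) := {w | w ∈ hartogs ∧ w.1 / w.2 ∈ A ∧ w.2 ∈ B}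

lemma hartogsProd_subset (A B : Set ℂ) : hartogsProd A B ⊆ hartogs := fun _ hw => hw.1

lemma measurableSet_hartogsProd {A B : Set ℂ} (hA : MeasurableSet A) (hB : MeasurableSet B) :
    MeasurableSet (hartogsProd A B) :=
  measurableSet_hartogs.inter (((measurable_fst.div measurable_snd) hA).inter (measurable_snd hB))

lemma uMeasure_hartogsProd {A B : Set ℂ} (hA : MeasurableSet A) (hB : MeasurableSet B)
    (hAD : A ⊆ disc) (hBD : B ⊆ disc) :
    uMeasure (hartogsProd A B) = volume A * volume B := by
  have hm := measurableSet_hartogsProd hA hB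
  rw [← Measure.restrict_eq_self uMeasure (hartogsProd_subset A B),
    ← measurePreserving_bidiscMap.measure_preimage hm.nullMeasurableSet,
    ← Measure.prod_prod, ← Measure.volume_eq_prod,
    ← Measure.restrict_eq_self volume (prod_mono hAD hBD)]
  refine measure_congr ?_
  have hne : ∀ᵐ q : ℂ × ℂ ∂(volume.restrict (disc ×ˢ disc)), q.2 ≠ 0 := by
    refine ae_restrict_of_ae ?_
    rw [Measure.volume_eq_prod]
    exact Measure.quasiMeasurePreserving_snd.ae (Measure.ae_ne volume (0 : ℂ))
  filter_upwards [hne, ae_restrict_mem (measurableSet_disc.prod measurableSet_disc)] with q hq hqD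
  have h1 : (q.1 * q.2) / q.2 = q.1 := mul_div_cancel_right₀ _ hq
  refine propext ?_
  change (bidiscMap q ∈ hartogs ∧ (q.1 * q.2) / q.2 ∈ A ∧ q.2 ∈ B) ↔ (q.1 ∈ A ∧ q.2 ∈ B)
  rw [h1, bidiscMap_mem_hartogs_iff hq]
  exact and_iff_right hqD

lemma volume_disc_lt_top : volume disc < ∞ := by
  rw [disc_eq_ball]; exact measure_ball_lt_top

lemma uMeasure_hartogs_lt_top : uMeasure hartogs < ∞ := by
  have h : hartogs = hartogsProd disc disc := by
    ext w
    exact ⟨fun hw => ⟨hw, div_mem_disc_of_mem_hartogs hw, hw.2⟩, fun hw => hw.1⟩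
  rw [h, uMeasure_hartogsProd measurableSet_disc measurableSet_disc subset_rfl subset_rfl]
  exact ENNReal.mul_lt_top volume_disc_lt_top volume_disc_lt_top

/-! ### The Bergman kernel of the Hartogs triangle. -/

/-- `π²` times the Bergman kernel of the Hartogs triangle. -/
noncomputable def hartogsKernel (z w : ℂ × ℂ) : ℂ :=
  (z.2 * conj w.2)⁻¹ * (((1 - z.1 / z.2 * conj (w.1 / w.2)) ^ 2)⁻¹ *
    ((1 - z.2 * conj w.2) ^ 2)⁻¹)

lemma continuousOn_hartogsKernel {z : ℂ × ℂ} (hz : z ∈ hartogs) :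
    ContinuousOn (hartogsKernel z) hartogs := by
  have hdiv : ContinuousOn (fun w : ℂ × ℂ => w.1 / w.2) hartogs :=
    continuousOn_fst.div continuousOn_snd fun w hw => snd_ne_zero_of_mem_hartogs hw
  refine ContinuousOn.mul (ContinuousOn.inv₀ (by fun_prop) fun w hw => ?_) (ContinuousOn.mul ?_ ?_)
  · exact mul_ne_zero (snd_ne_zero_of_mem_hartogs hz)
      ((map_ne_zero _).2 (snd_ne_zero_of_mem_hartogs hw))
  · exact (continuousOn_bergmanKernel (div_mem_disc_of_mem_hartogs hz)).comp hdiv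
      fun w hw => div_mem_disc_of_mem_hartogs hw
  · exact (continuousOn_bergmanKernel hz.2).comp continuousOn_snd fun w hw => hw.2

lemma differentiableOn_conj_hartogsKernel {z : ℂ × ℂ} (hz : z ∈ hartogs) :
    DifferentiableOn ℂ (fun w => conj (hartogsKernel z w)) hartogs := by
  have h : ∀ w, conj (hartogsKernel z w) = (conj z.2 * w.2)⁻¹ *
      (((1 - conj (z.1 / z.2) * (w.1 / w.2)) ^ 2)⁻¹ * ((1 - conj z.2 * w.2) ^ 2)⁻¹) := by
    intro w
    simp [hartogsKernel]
  simp only [h]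
  have hne : ∀ {a t : ℂ}, a ∈ disc → t ∈ disc → (1 - conj a * t) ^ 2 ≠ 0 := fun {a t} ha ht => by
    have h1 := (map_ne_zero (starRingEnd ℂ)).2 (one_sub_mul_conj_ne_zero ha ht)
    simpa using h1
  have hdiv : DifferentiableOn ℂ (fun w : ℂ × ℂ => w.1 / w.2) hartogs := by
    simp only [div_eq_mul_inv]
    exact differentiableOn_fst.mul
      (differentiableOn_snd.inv fun w hw => snd_ne_zero_of_mem_hartogs hw)
  refine DifferentiableOn.mul (DifferentiableOn.inv (by fun_prop) fun w hw => ?_)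
    (DifferentiableOn.mul (DifferentiableOn.inv ?_ fun w hw => ?_)
      (DifferentiableOn.inv (by fun_prop) fun w hw => ?_))
  · exact mul_ne_zero ((map_ne_zero _).2 (snd_ne_zero_of_mem_hartogs hz))
      (snd_ne_zero_of_mem_hartogs hw)
  · exact ((differentiableOn_const 1).sub (hdiv.const_mul _)).pow 2
  · exact hne (div_mem_disc_of_mem_hartogs hz) (div_mem_disc_of_mem_hartogs hw)
  · exact hne hz.2 hw.2

/-- For fixed `z` the kernel is at most a constant times `|w₂|⁻¹`, and `|w₂|⁻² dV = du` has finite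
mass on the triangle. -/
lemma memLp_hartogsKernel {z : ℂ × ℂ} (hz : z ∈ hartogs) :
    MemLp (fun w => conj (hartogsKernel z w)) 2 (volume.restrict hartogs) := by
  have hm : AEStronglyMeasurable (fun w => conj (hartogsKernel z w)) (volume.restrict hartogs) :=
    (differentiableOn_conj_hartogsKernel hz).continuousOn.aestronglyMeasurable measurableSet_hartogs
  rw [memLp_two_iff_integrable_sq_norm hm]
  have h1 : IntegrableOn (fun _ : ℂ × ℂ => (1 : ℝ)) hartogs uMeasure :=
    integrableOn_const uMeasure_hartogs_lt_top.ne
  have h2 : IntegrableOn (fun w : ℂ × ℂ => (‖w.2‖ ^ 2)⁻¹) hartogs := by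
    rw [integrableOn_hartogs_iff]
    refine h1.congr ?_
    filter_upwards [ae_restrict_mem measurableSet_hartogs] with w hw
    have : 0 < ‖w.2‖ := norm_pos_iff.2 (snd_ne_zero_of_mem_hartogs hw)
    rw [smul_eq_mul, mul_inv_cancel₀ (by positivity)]
  refine (h2.const_mul ((‖z.2‖⁻¹ * (((1 - ‖z.1 / z.2‖) ^ 2)⁻¹ * ((1 - ‖z.2‖) ^ 2)⁻¹)) ^ 2)).mono'
    (hm.norm.pow 2) ?_
  filter_upwards [ae_restrict_mem measurableSet_hartogs] with w hw
  rw [norm_pow, norm_norm, RCLike.norm_conj, ← inv_pow ‖w.2‖, ← mul_pow]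
  refine pow_le_pow_left₀ (norm_nonneg _) ?_ 2
  rw [hartogsKernel, norm_mul, norm_mul, norm_inv (z.2 * _), norm_mul z.2, RCLike.norm_conj, mul_inv]
  have k1 := norm_inv_one_sub_sq_le (div_mem_disc_of_mem_hartogs hz) (div_mem_disc_of_mem_hartogs hw)
  have k2 := norm_inv_one_sub_sq_le (a := z.2) (t := w.2) hz.2 hw.2
  calc ‖z.2‖⁻¹ * ‖w.2‖⁻¹ * _ ≤ ‖z.2‖⁻¹ * ‖w.2‖⁻¹ *
        (((1 - ‖z.1 / z.2‖) ^ 2)⁻¹ * ((1 - ‖z.2‖) ^ 2)⁻¹) := by gcongr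
    _ = _ := by ring

/-- The reproducing property of the Bergman kernel of the Hartogs triangle. -/
theorem integral_hartogsKernel_mul {g : ℂ × ℂ → ℂ} (hg : DifferentiableOn ℂ g hartogs)
    (hg2 : IntegrableOn (fun w => ‖g w‖ ^ 2) hartogs) {z : ℂ × ℂ} (hz : z ∈ hartogs) :
    ∫ w in hartogs, hartogsKernel z w * g w = Real.pi ^ 2 * g z := by
  have hmDD : MeasurableSet (disc ×ˢ disc) := measurableSet_disc.prod measurableSet_disc
  have hz0 := snd_ne_zero_of_mem_hartogs hz
  -- The factor `s` is a holomorphic square root of the Jacobian `|s|²`, so `g ↦ G` preserves `L²`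
  -- norms and holomorphy off `s = 0`.
  set G : ℂ × ℂ → ℂ := fun q => q.2 * g (bidiscMap q) with hG
  have hne : ∀ᵐ q : ℂ × ℂ ∂(volume.restrict (disc ×ˢ disc)), q.2 ≠ 0 := by
    refine ae_restrict_of_ae ?_
    rw [Measure.volume_eq_prod]
    exact Measure.quasiMeasurePreserving_snd.ae (Measure.ae_ne volume (0 : ℂ))
  have hGd : DifferentiableOn ℂ G (disc ×ˢ (disc \ {0})) := by
    refine differentiableOn_snd.mul (hg.comp ?_ fun q hq => ?_)
    · unfold bidiscMap; fun_prop
    · exact (bidiscMap_mem_hartogs_iff hq.2.2).2 ⟨hq.1, hq.2.1⟩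
  have hu : IntegrableOn (fun w => ‖w.2 * g w‖ ^ 2) hartogs uMeasure := by
    rw [integrableOn_hartogs_iff] at hg2
    refine hg2.congr (Eventually.of_forall fun w => ?_)
    simp only [norm_mul, smul_eq_mul]
    ring
  have hG2 : IntegrableOn (fun q => ‖G q‖ ^ 2) (disc ×ˢ disc) :=
    measurePreserving_bidiscMap.integrable_comp_of_integrable hu
  have hvol : IsFiniteMeasure (volume.restrict (disc ×ˢ disc)) := by
    refine isFiniteMeasure_restrict.2 ?_
    rw [Measure.volume_eq_prod, Measure.prod_prod]
    exact (ENNReal.mul_lt_top volume_disc_lt_top volume_disc_lt_top).ne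
  have hGm : AEStronglyMeasurable G (volume.restrict (disc ×ˢ disc)) := by
    have h1 : AEStronglyMeasurable (fun w : ℂ × ℂ => w.2 * g w) (uMeasure.restrict hartogs) :=
      (continuousOn_snd.mul hg.continuousOn).aestronglyMeasurable measurableSet_hartogs
    exact h1.comp_measurePreserving measurePreserving_bidiscMap
  have hGi : IntegrableOn G (disc ×ˢ disc) :=
    ((memLp_two_iff_integrable_sq_norm hGm).2 hG2).integrable (by norm_num)
  have key := integral_bidisc_mul_bergmanKernel hGd hGi hG2 (div_mem_disc_of_mem_hartogs hz)
    hz.2 hz0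
  have hGz : G (z.1 / z.2, z.2) = z.2 * g z := by
    simp only [hG, bidiscMap, div_mul_cancel₀ _ hz0]
  have hmeas : AEStronglyMeasurable (fun w : ℂ × ℂ => (‖w.2‖ ^ 2 : ℝ) • (hartogsKernel z w * g w))
      (uMeasure.restrict hartogs) := by
    refine ContinuousOn.aestronglyMeasurable ?_ measurableSet_hartogs
    have h1 : ContinuousOn (fun w : ℂ × ℂ => (‖w.2‖ ^ 2 : ℝ)) hartogs := by fun_prop
    exact h1.smul ((continuousOn_hartogsKernel hz).mul hg.continuousOn)
  rw [integral_hartogs, ← measurePreserving_bidiscMap.map_eq,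
    integral_map continuous_bidiscMap.aemeasurable (by
      rw [measurePreserving_bidiscMap.map_eq]; exact hmeas)]
  rw [hGz] at key
  have : Real.pi ^ 2 * g z = z.2⁻¹ * (Real.pi ^ 2 * (z.2 * g z)) := by field_simp
  rw [this, ← key, ← integral_const_mul]
  refine integral_congr_ae ?_
  filter_upwards [hne] with q hq
  have hd : (bidiscMap q).1 / q.2 = q.1 := mul_div_cancel_right₀ _ hq
  have hs : (bidiscMap q).2 = q.2 := rfl
  have hn : ((‖q.2‖ ^ 2 : ℝ) : ℂ) = q.2 * conj q.2 := by
    rw [mul_conj, normSq_eq_norm_sq]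
  have hcq : conj q.2 ≠ 0 := (map_ne_zero _).2 hq
  simp only [hartogsKernel, hs, hd, hG, real_smul, hn, mul_inv]
  field_simp

/-- The Bergman projection of the Hartogs triangle is integration against the Bergman kernel. -/
theorem bergmanProjection_ae_eq (f : L2 hartogs) :
    (bergmanProjection hartogs f : ℂ × ℂ → ℂ) =ᵐ[volume.restrict hartogs]
      fun z => (Real.pi ^ 2 : ℂ)⁻¹ * ∫ w in hartogs, hartogsKernel z w * f w := by
  have hpi : (Real.pi : ℂ) ≠ 0 := by exact_mod_cast Real.pi_ne_zero
  let k : ∀ z ∈ hartogs, L2 hartogs := fun z hz => (memLp_hartogsKernel hz).toLp _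
  have hkmem : ∀ z hz, k z hz ∈ bergmanSpace hartogs := fun z hz =>
    ⟨_, differentiableOn_conj_hartogsKernel hz, (memLp_hartogsKernel hz).coeFn_toLp⟩
  have hinner : ∀ z hz (h : L2 hartogs),
      inner ℂ (k z hz) h = ∫ w in hartogs, hartogsKernel z w * h w := by
    intro z hz h
    rw [L2.inner_def]
    refine integral_congr_ae ?_
    filter_upwards [(memLp_hartogsKernel hz).coeFn_toLp] with w hw
    rw [hw, RCLike.inner_apply, conj_conj, mul_comm]
  have hrep : ∀ h ∈ bergmanSpace hartogs, ∀ᵐ z ∂(volume.restrict hartogs), ∀ hz : z ∈ hartogs,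
      (h : ℂ × ℂ → ℂ) z = (Real.pi ^ 2 : ℂ)⁻¹ * inner ℂ (k z hz) h := by
    rintro h ⟨g, hg, he⟩
    have hg2 : IntegrableOn (fun w => ‖g w‖ ^ 2) hartogs :=
      ((Lp.memLp h).ae_eq he).integrable_norm_pow (by norm_num)
    filter_upwards [he] with z hzz hz
    rw [hinner z hz, hzz]
    have h2 := integral_hartogsKernel_mul hg hg2 hz
    have h3 : ∫ w in hartogs, hartogsKernel z w * h w = ∫ w in hartogs, hartogsKernel z w * g w := by
      refine integral_congr_ae ?_
      filter_upwards [he] with w hw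
      rw [hw]
    rw [h3, h2]
    field_simp
  -- The reproducing formula survives `L²` limits along an almost everywhere convergent subsequence,
  -- so closedness of the Bergman space is not needed.
  have hclos : ∀ h ∈ (bergmanSpace hartogs).topologicalClosure,
      ∀ᵐ z ∂(volume.restrict hartogs), ∀ hz : z ∈ hartogs,
      (h : ℂ × ℂ → ℂ) z = (Real.pi ^ 2 : ℂ)⁻¹ * inner ℂ (k z hz) h := by
    intro h hh
    obtain ⟨u, hu, hlim⟩ := mem_closure_iff_seq_limit.1 hh
    obtain ⟨ns, hns, hae⟩ := (tendstoInMeasure_of_tendsto_Lp hlim).exists_seq_tendsto_ae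
    have hall : ∀ᵐ z ∂(volume.restrict hartogs), ∀ n, ∀ hz : z ∈ hartogs,
        (u n : ℂ × ℂ → ℂ) z = (Real.pi ^ 2 : ℂ)⁻¹ * inner ℂ (k z hz) (u n) :=
      ae_all_iff.2 fun n => hrep _ (hu n)
    filter_upwards [hae, hall] with z h1 h2 hz
    refine tendsto_nhds_unique h1 ?_
    simp only [h2 _ hz]
    refine Tendsto.const_mul _ ?_
    exact (tendsto_const_nhds.inner hlim).comp hns.tendsto_atTop
  have hP : bergmanProjection hartogs f ∈ (bergmanSpace hartogs).topologicalClosure :=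
    Submodule.starProjection_apply_mem _ _
  filter_upwards [hclos _ hP, ae_restrict_mem measurableSet_hartogs] with z h1 hz
  -- `Pf(z)` is a multiple of `⟨k_z, Pf⟩ = ⟨P k_z, f⟩ = ⟨k_z, f⟩`.
  rw [h1 hz, ← hinner z hz, bergmanProjection, ← Submodule.inner_starProjection_left_eq_right,
    Submodule.starProjection_eq_self_iff.2 (Submodule.le_topologicalClosure _ (hkmem z hz))]

/-! ### The weight and its dual with respect to `du`. -/

/-- The weight `μ |w₂|^{2-p}` with respect to `du`. -/
noncomputable def scaledWeight (p : ℝ) (μ : ℂ × ℂ → ℝ) (w : ℂ × ℂ) : ℝ := μ w * ‖w.2‖ ^ (2 - p)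

/-- The dual weight `|w₂|² ν` with respect to `du`. -/
noncomputable def scaledDual (p : ℝ) (μ : ℂ × ℂ → ℝ) (w : ℂ × ℂ) : ℝ :=
  ‖w.2‖ ^ 2 * dualWeight p μ w

section

variable {p : ℝ} {μ : ℂ × ℂ → ℝ} {w : ℂ × ℂ}

lemma scaledWeight_pos (hw : w.2 ≠ 0) (hμ : 0 < μ w) : 0 < scaledWeight p μ w := by
  have : 0 < ‖w.2‖ := norm_pos_iff.2 hw
  unfold scaledWeight; positivity

lemma scaledDual_pos (hw : w.2 ≠ 0) (hμ : 0 < μ w) : 0 < scaledDual p μ w := by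
  have : 0 < ‖w.2‖ := norm_pos_iff.2 hw
  unfold scaledDual dualWeight; positivity

/-- Since `(p - 1)p' = p`, the powers of `|w₂|` and of `μ` both cancel. This is the `A_p` duality
between the two scaled weights. -/
lemma scaledDual_rpow_mul_scaledWeight (hp : 1 < p) (hw : w.2 ≠ 0) (hμ : 0 < μ w) :
    scaledDual p μ w ^ (p - 1) * scaledWeight p μ w = 1 := by
  have hr : 0 < ‖w.2‖ := norm_pos_iff.2 hw
  have hp1 : p - 1 ≠ 0 := by linarith
  have hp0 : p ≠ 0 := by linarith
  unfold scaledDual dualWeight scaledWeight Real.conjExponent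
  rw [← Real.rpow_natCast, ← Real.exp_log hμ]
  simp only [Real.rpow_def_of_pos hr, Real.rpow_def_of_pos (Real.exp_pos _), ← Real.exp_add,
    Real.log_exp]
  rw [Real.exp_eq_one_iff]
  push_cast
  field_simp
  ring

end

section

variable {p : ℝ} {μ : ℂ × ℂ → ℝ}

lemma uMeasure_restrict_absolutelyContinuous :
    uMeasure.restrict hartogs ≪ volume.restrict hartogs :=
  (withDensity_absolutelyContinuous _ _).restrict _

lemma weightedMeasure_absolutelyContinuous (μ : ℂ × ℂ → ℝ) :
    weightedMeasure μ ≪ volume.restrict hartogs := withDensity_absolutelyContinuous _ _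

lemma IsWeight.aemeasurable (hμ : IsWeight μ) : AEMeasurable μ (volume.restrict hartogs) :=
  hμ.locallyIntegrableOn.aestronglyMeasurable.aemeasurable

lemma IsWeight.ae_uMeasure (hμ : IsWeight μ) :
    ∀ᵐ w ∂(uMeasure.restrict hartogs), w ∈ hartogs ∧ w.2 ≠ 0 ∧ 0 < μ w := by
  filter_upwards [uMeasure_restrict_absolutelyContinuous.ae_le hμ.pos,
    ae_restrict_mem measurableSet_hartogs] with w h1 h2
  exact ⟨h2, snd_ne_zero_of_mem_hartogs h2, h1⟩

lemma IsWeight.aemeasurable_scaledWeight (hμ : IsWeight μ) (p : ℝ) :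
    AEMeasurable (scaledWeight p μ) (uMeasure.restrict hartogs) := by
  have h := hμ.aemeasurable.mono_ac uMeasure_restrict_absolutelyContinuous
  exact h.mul (Measurable.aemeasurable (by fun_prop))

lemma IsWeight.aemeasurable_scaledDual_volume (hμ : IsWeight μ) (p : ℝ) :
    AEMeasurable (scaledDual p μ) (volume.restrict hartogs) :=
  (Measurable.aemeasurable (by fun_prop)).mul
    ((Measurable.aemeasurable (by fun_prop)).mul (hμ.aemeasurable.pow_const _))

lemma IsWeight.aemeasurable_scaledDual (hμ : IsWeight μ) (p : ℝ) :
    AEMeasurable (scaledDual p μ) (uMeasure.restrict hartogs) :=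
  (hμ.aemeasurable_scaledDual_volume p).mono_ac uMeasure_restrict_absolutelyContinuous

lemma ofReal_sq_mul_ofReal_mul_rpow (hp : 0 < p) (m : ℝ) {r : ℝ} (hr : 0 < r) (x : ℝ≥0∞) :
    ENNReal.ofReal (r ^ 2) * (ENNReal.ofReal m * x ^ p) =
      (ENNReal.ofReal r * x) ^ p * ENNReal.ofReal (m * r ^ (2 - p)) := by
  have h : r ^ 2 = r ^ p * r ^ (2 - p) := by
    rw [← Real.rpow_add hr, ← Real.rpow_natCast]; norm_num
  rw [ENNReal.mul_rpow_of_nonneg _ _ hp.le, ENNReal.ofReal_rpow_of_pos hr,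
    ENNReal.ofReal_mul' (by positivity), h, ENNReal.ofReal_mul (by positivity)]
  ring

/-- Multiplication by `w₂` becomes an isometry into `L^p(W du)`: `|w₂|² μ = |w₂|^p W`. -/
lemma eLpNorm_rpow_weightedMeasure (hp : 1 < p) (hμ : IsWeight μ) (f : ℂ × ℂ → ℂ) :
    eLpNorm f (ENNReal.ofReal p) (weightedMeasure μ) ^ p =
      ∫⁻ w in hartogs, (ENNReal.ofReal ‖w.2‖ * ‖f w‖ₑ) ^ p * ENNReal.ofReal (scaledWeight p μ w)
        ∂uMeasure := by
  have hp0 : 0 < p := by linarith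
  rw [eLpNorm_eq_lintegral_rpow_enorm_toReal (by simpa using hp0) ENNReal.ofReal_ne_top,
    ENNReal.toReal_ofReal hp0.le, ← ENNReal.rpow_mul, one_div_mul_cancel hp0.ne', ENNReal.rpow_one,
    weightedMeasure, lintegral_withDensity_eq_lintegral_mul_non_measurable₀ _
      hμ.aemeasurable.ennreal_ofReal (Eventually.of_forall fun _ => ENNReal.ofReal_lt_top),
    lintegral_hartogs]
  refine setLIntegral_congr_fun measurableSet_hartogs fun w hw => ?_
  exact ofReal_sq_mul_ofReal_mul_rpow hp0 _ (norm_pos_iff.2 (snd_ne_zero_of_mem_hartogs hw)) _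

/-- Hölder's inequality for a weight and its dual. -/
lemma uMeasure_rpow_le (hp : 1 < p) (hμ : IsWeight μ) {F : Set (ℂ × ℂ)} (hF : F ⊆ hartogs) :
    uMeasure F ^ p ≤ (∫⁻ w in F, ENNReal.ofReal (scaledWeight p μ w) ∂uMeasure) *
      (∫⁻ w in F, ENNReal.ofReal (scaledDual p μ w) ∂uMeasure) ^ (p - 1) := by
  have hp0 : 0 < p := by linarith
  have hpq := Real.HolderConjugate.conjExponent hp
  set q := p.conjExponent with hq
  have hq0 : 0 < q := hpq.symm.pos
  have hle := Measure.restrict_mono_set uMeasure hF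
  have hW : AEMeasurable (fun w => ENNReal.ofReal (scaledWeight p μ w)) (uMeasure.restrict F) :=
    (hμ.aemeasurable_scaledWeight p).ennreal_ofReal.mono_measure hle
  have hS : AEMeasurable (fun w => ENNReal.ofReal (scaledDual p μ w)) (uMeasure.restrict F) :=
    (hμ.aemeasurable_scaledDual p).ennreal_ofReal.mono_measure hle
  have h := ENNReal.lintegral_mul_le_Lp_mul_Lq _ hpq (hW.pow_const (1 / p)) (hS.pow_const (1 / q))
  have hone : ∫⁻ w in F, ((fun w => ENNReal.ofReal (scaledWeight p μ w) ^ (1 / p)) *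
      fun w => ENNReal.ofReal (scaledDual p μ w) ^ (1 / q)) w ∂uMeasure = uMeasure F := by
    rw [← setLIntegral_one]
    refine lintegral_congr_ae ?_
    filter_upwards [ae_mono hle hμ.ae_uMeasure] with w ⟨_, h2, h3⟩
    have k1 := scaledDual_rpow_mul_scaledWeight hp h2 h3
    have k2 := scaledDual_pos (p := p) h2 h3
    have k3 := scaledWeight_pos (p := p) h2 h3
    have hq' : 1 / q = (p - 1) * (1 / p) := by
      rw [hq, Real.conjExponent]; field_simp
    rw [Pi.mul_apply, hq', ENNReal.rpow_mul, ← ENNReal.mul_rpow_of_nonneg _ _ (by positivity),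
      ENNReal.ofReal_rpow_of_pos k2, ← ENNReal.ofReal_mul k3.le, mul_comm, k1]
    simp
  simp only [hone, ← ENNReal.rpow_mul, one_div_mul_cancel hp0.ne', one_div_mul_cancel hq0.ne',
    ENNReal.rpow_one] at h
  have h2 := ENNReal.rpow_le_rpow h hp0.le
  rw [ENNReal.mul_rpow_of_nonneg _ _ hp0.le, ← ENNReal.rpow_mul, ← ENNReal.rpow_mul,
    one_div_mul_cancel hp0.ne', ENNReal.rpow_one] at h2
  have hqp : 1 / q * p = p - 1 := by
    rw [hq, Real.conjExponent]; field_simp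
  rwa [hqp] at h2

/-! ### Testing the projection off the diagonal. -/

/-- The factor of the Bergman kernel of the Hartogs triangle that comes from the bidisc. -/
noncomputable def bidiscKernel (z w : ℂ × ℂ) : ℂ :=
  ((1 - z.1 / z.2 * conj (w.1 / w.2)) ^ 2)⁻¹ * ((1 - z.2 * conj w.2) ^ 2)⁻¹

lemma continuousOn_bidiscKernel {z : ℂ × ℂ} (hz : z ∈ hartogs) :
    ContinuousOn (bidiscKernel z) hartogs := by
  have hdiv : ContinuousOn (fun w : ℂ × ℂ => w.1 / w.2) hartogs :=
    continuousOn_fst.div continuousOn_snd fun w hw => snd_ne_zero_of_mem_hartogs hw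
  exact ((continuousOn_bergmanKernel (div_mem_disc_of_mem_hartogs hz)).comp hdiv
      fun w hw => div_mem_disc_of_mem_hartogs hw).mul
    ((continuousOn_bergmanKernel hz.2).comp continuousOn_snd fun w hw => hw.2)

/-- Lower bound for the Bergman projection of `φ / w₂`, when `φ ≥ 0` is supported on a set on which
the real part of the kernel is bounded below. -/
lemma le_norm_integral_hartogsKernel {E : Set (ℂ × ℂ)} {φ : ℂ × ℂ → ℝ} {z : ℂ × ℂ} {δ : ℝ}
    (hz : z ∈ hartogs) (hφ : IntegrableOn φ hartogs uMeasure) (hφE : ∀ w ∉ E, φ w = 0)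
    (hφ0 : ∀ᵐ w ∂(uMeasure.restrict hartogs), 0 ≤ φ w)
    (hker : ∀ w ∈ E, δ ≤ (bidiscKernel z w).re) :
    δ * ∫ w in hartogs, φ w ∂uMeasure ≤
      ‖z.2‖ * ‖∫ w in hartogs, hartogsKernel z w * (φ w / w.2)‖ := by
  have hz0 := snd_ne_zero_of_mem_hartogs hz
  have heq : ∫ w in hartogs, hartogsKernel z w * (φ w / w.2) =
      z.2⁻¹ * ∫ w in hartogs, φ w * bidiscKernel z w ∂uMeasure := by
    rw [integral_hartogs, ← integral_const_mul]
    refine setIntegral_congr_fun measurableSet_hartogs fun w hw => ?_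
    have hw0 := snd_ne_zero_of_mem_hartogs hw
    have hn : ((‖w.2‖ ^ 2 : ℝ) : ℂ) = w.2 * conj w.2 := by rw [mul_conj, normSq_eq_norm_sq]
    have hc : conj w.2 ≠ 0 := (map_ne_zero _).2 hw0
    change (‖w.2‖ ^ 2 : ℝ) • (((z.2 * conj w.2)⁻¹ * bidiscKernel z w) * (φ w / w.2)) =
      z.2⁻¹ * (φ w * bidiscKernel z w)
    rw [real_smul, hn, mul_inv]
    field_simp
  have hint : IntegrableOn (fun w => (φ w : ℂ) * bidiscKernel z w) hartogs uMeasure := by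
    refine Integrable.mul_bdd (c := ((1 - ‖z.1 / z.2‖) ^ 2)⁻¹ * ((1 - ‖z.2‖) ^ 2)⁻¹) hφ.ofReal
      ((continuousOn_bidiscKernel hz).aestronglyMeasurable measurableSet_hartogs) ?_
    filter_upwards [ae_restrict_mem measurableSet_hartogs] with w hw
    rw [bidiscKernel, norm_mul]
    exact mul_le_mul
      (norm_inv_one_sub_sq_le (div_mem_disc_of_mem_hartogs hz) (div_mem_disc_of_mem_hartogs hw))
      (norm_inv_one_sub_sq_le (a := z.2) (t := w.2) hz.2 hw.2) (norm_nonneg _) (by positivity)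
  rw [heq, norm_mul, norm_inv, mul_inv_cancel_left₀ (norm_ne_zero_iff.2 hz0)]
  refine le_trans ?_ (re_le_norm _)
  have hre := integral_re (𝕜 := ℂ) hint
  change ∫ w in hartogs, ((φ w : ℂ) * bidiscKernel z w).re ∂uMeasure =
    (∫ w in hartogs, (φ w : ℂ) * bidiscKernel z w ∂uMeasure).re at hre
  rw [← hre, ← integral_const_mul]
  refine integral_mono_ae (hφ.const_mul _) hint.re ?_
  filter_upwards [hφ0] with w hw
  change δ * φ w ≤ ((φ w : ℂ) * bidiscKernel z w).re
  rw [re_ofReal_mul]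
  by_cases hE : w ∈ E
  · have := hker w hE
    nlinarith
  · simp [hφE w hE]

end

section

variable {p : ℝ} {μ : ℂ × ℂ → ℝ}

/-- The dual weight `σ` need not be integrable. Its truncation `φ = min(σ, n) 1_E` is bounded, so `φ
/ w₂` is an admissible test function in `L²` and `A = ∫ φ du` is finite. From `φ^{p-1} W ≤ σ^{p-1} W
= 1` its norm to the power `p` is at most `A`, while `|z₂ P(φ/w₂)| ≥ δ A / π²` on `F`. -/
lemma setLIntegral_mul_rpow_le_of_truncation (hp : 1 < p) (hμ : IsWeight μ) {N : ℝ≥0∞}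
    (hN : IsBound p μ N) {E F : Set (ℂ × ℂ)} (hE : MeasurableSet E)
    (hFm : MeasurableSet F) (hFH : F ⊆ hartogs) {δ : ℝ} (hδ : 0 < δ)
    (hker : ∀ z ∈ F, ∀ w ∈ E, δ ≤ (bidiscKernel z w).re) (n : ℕ) :
    (∫⁻ w in F, ENNReal.ofReal (scaledWeight p μ w) ∂uMeasure) *
      (∫⁻ w in hartogs, ENNReal.ofReal (E.indicator (fun w => min (scaledDual p μ w) n) w)
        ∂uMeasure) ^ (p - 1) ≤ ENNReal.ofReal (Real.pi ^ 2 / δ) ^ p * N ^ p := by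
  have hp0 : 0 < p := by linarith
  set φ : ℂ × ℂ → ℝ := E.indicator (fun w => min (scaledDual p μ w) n) with hφ
  set A : ℝ≥0∞ := ∫⁻ w in hartogs, ENNReal.ofReal (φ w) ∂uMeasure with hA
  have hφE : ∀ w ∉ E, φ w = 0 := fun w hw => indicator_of_notMem hw _
  have hφmv : AEMeasurable φ (volume.restrict hartogs) :=
    ((hμ.aemeasurable_scaledDual_volume p).min aemeasurable_const).indicator hE
  have hφm : AEMeasurable φ (uMeasure.restrict hartogs) :=
    hφmv.mono_ac uMeasure_restrict_absolutelyContinuous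
  have hbd : ∀ w, w.2 ≠ 0 → 0 < μ w → 0 ≤ φ w ∧ φ w ≤ n ∧ φ w ≤ scaledDual p μ w := by
    intro w h1 h2
    have h3 := scaledDual_pos (p := p) h1 h2
    by_cases hw : w ∈ E
    · rw [hφ, indicator_of_mem hw]
      exact ⟨le_min h3.le (Nat.cast_nonneg n), min_le_right _ _, min_le_left _ _⟩
    · rw [hφE w hw]
      exact ⟨le_rfl, Nat.cast_nonneg n, h3.le⟩
  have hφ0 : ∀ᵐ w ∂(uMeasure.restrict hartogs), 0 ≤ φ w := by
    filter_upwards [hμ.ae_uMeasure] with w ⟨_, h1, h2⟩ using (hbd w h1 h2).1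
  have hconst : ∀ c : ℝ, IntegrableOn (fun _ : ℂ × ℂ => c) hartogs uMeasure := fun c =>
    integrableOn_const uMeasure_hartogs_lt_top.ne
  have hφi : IntegrableOn φ hartogs uMeasure := by
    refine (hconst n).mono' hφm.aestronglyMeasurable ?_
    filter_upwards [hμ.ae_uMeasure] with w ⟨_, h1, h2⟩
    rw [Real.norm_of_nonneg (hbd w h1 h2).1]
    exact (hbd w h1 h2).2.1
  have hA' : A = ENNReal.ofReal (∫ w in hartogs, φ w ∂uMeasure) :=
    (ofReal_integral_eq_lintegral_ofReal hφi hφ0).symm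
  have hAtop : A ≠ ∞ := hA' ▸ ENNReal.ofReal_ne_top
  set f₀ : ℂ × ℂ → ℂ := fun w => φ w / w.2 with hf₀
  have hf₀m : AEStronglyMeasurable f₀ (volume.restrict hartogs) :=
    ((measurable_ofReal.comp_aemeasurable hφmv).div measurable_snd.aemeasurable).aestronglyMeasurable
  have hf₀L : MemLp f₀ 2 (volume.restrict hartogs) := by
    rw [memLp_two_iff_integrable_sq_norm hf₀m]
    refine integrableOn_hartogs_iff.2 ?_
    refine ((hconst ((n : ℝ) ^ 2)).mono' (hφm.pow_const 2).aestronglyMeasurable ?_).congr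
      (f := fun w => φ w ^ 2) ?_
    · filter_upwards [hμ.ae_uMeasure] with w ⟨_, h1, h2⟩
      obtain ⟨k1, k2, _⟩ := hbd w h1 h2
      rw [Real.norm_of_nonneg (by positivity)]
      gcongr
    · filter_upwards [hμ.ae_uMeasure] with w ⟨_, h1, h2⟩
      have : 0 < ‖w.2‖ := norm_pos_iff.2 h1
      simp only [hf₀, norm_div, norm_real, smul_eq_mul, div_pow, Real.norm_eq_abs, sq_abs]
      field_simp
  set f : L2 hartogs := hf₀L.toLp f₀
  have hff : (f : ℂ × ℂ → ℂ) =ᵐ[volume.restrict hartogs] f₀ := hf₀L.coeFn_toLp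
  have hnorm : eLpNorm f (ENNReal.ofReal p) (weightedMeasure μ) ^ p ≤ A := by
    rw [eLpNorm_congr_ae ((weightedMeasure_absolutelyContinuous μ).ae_le hff),
      eLpNorm_rpow_weightedMeasure hp hμ]
    refine lintegral_mono_ae ?_
    filter_upwards [hμ.ae_uMeasure] with w ⟨_, h1, h2⟩
    obtain ⟨k1, _, k3⟩ := hbd w h1 h2
    have hr : 0 < ‖w.2‖ := norm_pos_iff.2 h1
    have e1 : ENNReal.ofReal ‖w.2‖ * ‖f₀ w‖ₑ = ENNReal.ofReal (φ w) := by
      rw [← ofReal_norm, ← ENNReal.ofReal_mul hr.le]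
      simp only [hf₀, norm_div, norm_real, Real.norm_of_nonneg k1]
      rw [mul_div_cancel₀ _ hr.ne']
    rw [e1, ENNReal.ofReal_rpow_of_nonneg k1 hp0.le, ← ENNReal.ofReal_mul (by positivity)]
    refine ENNReal.ofReal_le_ofReal ?_
    have hW := (scaledWeight_pos (p := p) h1 h2).le
    calc φ w ^ p * scaledWeight p μ w = φ w * (φ w ^ (p - 1) * scaledWeight p μ w) := by
          rw [← mul_assoc]
          congr 1
          rw [← Real.rpow_one_add' k1 (by linarith)]
          congr 1; ring
      _ ≤ φ w * (scaledDual p μ w ^ (p - 1) * scaledWeight p μ w) := by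
          have : 0 ≤ p - 1 := by linarith
          gcongr
      _ = φ w := by rw [scaledDual_rpow_mul_scaledWeight hp h1 h2, mul_one]
  have hLp : MemLp f (ENNReal.ofReal p) (weightedMeasure μ) := by
    refine ⟨(Lp.aestronglyMeasurable f).mono_ac (weightedMeasure_absolutelyContinuous μ), ?_⟩
    have := hnorm.trans_lt hAtop.lt_top
    exact (ENNReal.rpow_lt_top_iff_of_pos hp0).1 this
  have hlow : ∀ᵐ z ∂(uMeasure.restrict F), ENNReal.ofReal (δ / Real.pi ^ 2) * A ≤
      ENNReal.ofReal ‖z.2‖ * ‖(bergmanProjection hartogs f : ℂ × ℂ → ℂ) z‖ₑ := by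
    filter_upwards [ae_mono (Measure.restrict_mono_set uMeasure hFH)
      (uMeasure_restrict_absolutelyContinuous.ae_le (bergmanProjection_ae_eq f)),
      ae_restrict_mem hFm] with z h1 hz
    have h2 := le_norm_integral_hartogsKernel (hFH hz) hφi hφE hφ0 (hker z hz)
    have h3 : ∫ w in hartogs, hartogsKernel z w * f w =
        ∫ w in hartogs, hartogsKernel z w * (φ w / w.2) := by
      refine integral_congr_ae ?_
      filter_upwards [hff] with w hw
      rw [hw]
    rw [h1, h3, hA', ← ofReal_norm, ← ENNReal.ofReal_mul (by positivity),
      ← ENNReal.ofReal_mul (by positivity)]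
    refine ENNReal.ofReal_le_ofReal ?_
    rw [norm_mul, norm_inv, norm_pow, norm_real, Real.norm_of_nonneg Real.pi_pos.le]
    calc _ = (Real.pi ^ 2)⁻¹ * (δ * ∫ w in hartogs, φ w ∂uMeasure) := by ring
      _ ≤ (Real.pi ^ 2)⁻¹ * (‖z.2‖ * ‖∫ w in hartogs, hartogsKernel z w * (φ w / w.2)‖) := by
          gcongr
      _ = _ := by ring
  have hmain : (ENNReal.ofReal (δ / Real.pi ^ 2) * A) ^ p *
      ∫⁻ w in F, ENNReal.ofReal (scaledWeight p μ w) ∂uMeasure ≤ N ^ p * A := by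
    calc _ ≤ ∫⁻ w in F, (ENNReal.ofReal (δ / Real.pi ^ 2) * A) ^ p *
          ENNReal.ofReal (scaledWeight p μ w) ∂uMeasure := lintegral_const_mul_le _ _
      _ ≤ ∫⁻ w in F, (ENNReal.ofReal ‖w.2‖ *
            ‖(bergmanProjection hartogs f : ℂ × ℂ → ℂ) w‖ₑ) ^ p *
          ENNReal.ofReal (scaledWeight p μ w) ∂uMeasure := by
          refine lintegral_mono_ae ?_
          filter_upwards [hlow] with w hw
          gcongr
      _ ≤ ∫⁻ w in hartogs, (ENNReal.ofReal ‖w.2‖ *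
            ‖(bergmanProjection hartogs f : ℂ × ℂ → ℂ) w‖ₑ) ^ p *
          ENNReal.ofReal (scaledWeight p μ w) ∂uMeasure := lintegral_mono_set hFH
      _ = eLpNorm (bergmanProjection hartogs f) (ENNReal.ofReal p) (weightedMeasure μ) ^ p :=
          (eLpNorm_rpow_weightedMeasure hp hμ _).symm
      _ ≤ (N * eLpNorm f (ENNReal.ofReal p) (weightedMeasure μ)) ^ p := by
          gcongr
          exact hN f hLp
      _ ≤ N ^ p * A := by
          rw [ENNReal.mul_rpow_of_nonneg _ _ hp0.le]
          gcongr
  -- The estimate `(δ A / π²)^p W(F) ≤ N^p A` is divided by `A`, which truncation has made finite.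
  rcases eq_or_ne A 0 with hA0 | hA0
  · rw [hA0, ENNReal.zero_rpow_of_pos (by linarith), mul_zero]
    exact zero_le
  · have hc : 0 < δ / Real.pi ^ 2 := by positivity
    have hc' : ENNReal.ofReal (δ / Real.pi ^ 2) ≠ 0 := by simpa using hc
    have hcp0 : ENNReal.ofReal (δ / Real.pi ^ 2) ^ p ≠ 0 :=
      (ENNReal.rpow_pos (pos_iff_ne_zero.2 hc') ENNReal.ofReal_ne_top).ne'
    have hcpt : ENNReal.ofReal (δ / Real.pi ^ 2) ^ p ≠ ∞ :=
      ENNReal.rpow_ne_top_of_nonneg hp0.le ENNReal.ofReal_ne_top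
    have hinv : ENNReal.ofReal (Real.pi ^ 2 / δ) ^ p = (ENNReal.ofReal (δ / Real.pi ^ 2) ^ p)⁻¹ := by
      rw [← ENNReal.inv_rpow, ← ENNReal.ofReal_inv_of_pos hc, inv_div]
    have hAp : A ^ p = A ^ (p - 1) * A := by
      conv_rhs => rw [← ENNReal.rpow_one A, ← ENNReal.rpow_mul, one_mul]
      rw [← ENNReal.rpow_add _ _ hA0 hAtop, sub_add_cancel]
    rw [ENNReal.mul_rpow_of_nonneg _ _ hp0.le, hAp] at hmain
    rw [hinv, mul_comm (_)⁻¹, ← div_eq_mul_inv, ENNReal.le_div_iff_mul_le (Or.inl hcp0)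
      (Or.inl hcpt), ← ENNReal.mul_le_mul_iff_left hA0 hAtop]
    refine le_trans (le_of_eq ?_) hmain
    ring

/-- Off-diagonal consequence of the boundedness of the Bergman projection. -/
theorem setLIntegral_mul_rpow_le (hp : 1 < p) (hμ : IsWeight μ) {N : ℝ≥0∞}
    (hN : IsBound p μ N) {E F : Set (ℂ × ℂ)} (hE : MeasurableSet E) (hEH : E ⊆ hartogs)
    (hFm : MeasurableSet F) (hFH : F ⊆ hartogs) {δ : ℝ} (hδ : 0 < δ)
    (hker : ∀ z ∈ F, ∀ w ∈ E, δ ≤ (bidiscKernel z w).re) :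
    (∫⁻ w in F, ENNReal.ofReal (scaledWeight p μ w) ∂uMeasure) *
      (∫⁻ w in E, ENNReal.ofReal (scaledDual p μ w) ∂uMeasure) ^ (p - 1) ≤
      ENNReal.ofReal (Real.pi ^ 2 / δ) ^ p * N ^ p := by
  have hp1 : 0 < p - 1 := by linarith
  have hsup : ∫⁻ w in E, ENNReal.ofReal (scaledDual p μ w) ∂uMeasure =
      ⨆ n : ℕ, ∫⁻ w in hartogs,
        ENNReal.ofReal (E.indicator (fun w => min (scaledDual p μ w) n) w) ∂uMeasure := by
    rw [← lintegral_iSup']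
    · rw [← inter_eq_self_of_subset_left hEH, ← Measure.restrict_restrict hE,
        ← lintegral_indicator hE, inter_eq_self_of_subset_left hEH]
      refine lintegral_congr fun w => ?_
      by_cases hw : w ∈ E
      · simp only [indicator_of_mem hw]
        refine le_antisymm ?_ (iSup_le fun n => ENNReal.ofReal_le_ofReal (min_le_left _ _))
        obtain ⟨n, hn⟩ := exists_nat_ge (scaledDual p μ w)
        refine le_iSup_of_le n ?_
        rw [min_eq_left hn]
      · simp [indicator_of_notMem hw]
    · intro n
      exact (((hμ.aemeasurable_scaledDual p).min aemeasurable_const).indicator hE).ennreal_ofReal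
    · refine Eventually.of_forall fun w m n hmn => ENNReal.ofReal_le_ofReal ?_
      exact indicator_le_indicator (min_le_min_left _ (Nat.cast_le.2 hmn))
  -- As `p - 1 > 0`, the power is an order isomorphism of `[0, ∞]` and commutes with the supremum
  -- from monotone convergence.
  rw [hsup, ← ENNReal.orderIsoRpow_apply (p - 1) hp1, OrderIso.map_iSup, ENNReal.mul_iSup]
  exact iSup_le fun n => setLIntegral_mul_rpow_le_of_truncation hp hμ hN hE hFm hFH hδ hker n

end

/-! ### Carleson tents and their companions. -/

lemma measurableSet_carlesonTent (z : ℂ) : MeasurableSet (carlesonTent z) := by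
  have h1 : IsOpen {w : ℂ | ‖1 - conj w * (z / (‖z‖ : ℂ))‖ < 1 - ‖z‖} :=
    isOpen_lt (by fun_prop) (by fun_prop)
  by_cases hz : z = 0
  · convert measurableSet_disc using 1
    ext w; simp [carlesonTent, hz]
  · convert measurableSet_disc.inter h1.measurableSet using 1
    ext w; simp [carlesonTent, hz]

lemma carlesonTent_subset_disc (z : ℂ) : carlesonTent z ⊆ disc := fun _ hw => hw.1

/-- Every Carleson tent of size `h` has a companion ball of comparable area against which the
function `1 - t s̄` is nearly a positive constant of order `h`. -/
lemma exists_companion {z : ℂ} (hz : z ∈ disc) : ∃ (S : Set ℂ) (a h : ℝ),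
    MeasurableSet S ∧ S ⊆ disc ∧ 0 < a ∧ 0 < h ∧ a ≤ 64 * h ∧
    volume S = ENNReal.ofReal (Real.pi * (h / 16) ^ 2) ∧ volume S ≤ volume (carlesonTent z) ∧
    ∀ t ∈ carlesonTent z, ∀ s ∈ S, ‖1 - t * conj s - a‖ ≤ a / 16 := by
  have hz' : ‖z‖ < 1 := hz
  obtain ⟨ζ, hζ, hζz⟩ : ∃ ζ : ℂ, ‖ζ‖ = 1 ∧ (z ≠ 0 → z / (‖z‖ : ℂ) = ζ) := by
    by_cases h0 : z = 0
    · exact ⟨1, by simp, fun h => absurd h0 h⟩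
    · exact ⟨z / (‖z‖ : ℂ), by simp [h0], fun _ => rfl⟩
  set h : ℝ := 1 - ‖z‖ with hh
  have hh0 : 0 < h := by linarith
  have hh1 : h ≤ 1 := by linarith [norm_nonneg z]
  have hζc : ζ * conj ζ = 1 := by rw [mul_conj, normSq_eq_norm_sq, hζ]; simp
  have hdist : ∀ w : ℂ, ‖1 - conj w * ζ‖ = ‖w - ζ‖ := fun w => by
    have : 1 - conj w * ζ = ζ * conj (ζ - w) := by rw [map_sub, mul_sub, hζc]; ring
    rw [this, norm_mul, hζ, one_mul, RCLike.norm_conj, norm_sub_rev]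
  have hvol : ∀ (c : ℂ) {r : ℝ}, 0 ≤ r → volume (ball c r) = ENNReal.ofReal (Real.pi * r ^ 2) := by
    intro c r hr
    rw [Complex.volume_ball, ENNReal.ofReal_mul Real.pi_pos.le, ENNReal.ofReal_pow hr, mul_comm,
      ← NNReal.coe_real_pi, ENNReal.ofReal_coe_nnreal]
  have hT : ∀ t ∈ carlesonTent z, ‖t - ζ‖ ≤ 2 * h := by
    intro t ht
    by_cases h0 : z = 0
    · have ht' : ‖t‖ < 1 := ht.1
      have h1 : h = 1 := by simp [hh, h0]
      have := norm_sub_le t ζ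
      linarith
    · have := ht.2 h0
      rw [hζz h0, hdist] at this
      linarith
  -- This inscribed ball is what makes the tent at least as large in area as the companion of radius
  -- `h/16`.
  have hball : ball (((1 - h / 2 : ℝ) : ℂ) * ζ) (h / 2) ⊆ carlesonTent z := by
    intro w hw
    rw [mem_ball, dist_eq_norm] at hw
    have hc : ‖((1 - h / 2 : ℝ) : ℂ) * ζ‖ = 1 - h / 2 := by
      rw [norm_mul, hζ, norm_real, mul_one, Real.norm_of_nonneg (by linarith)]
    have hc2 : ‖((1 - h / 2 : ℝ) : ℂ) * ζ - ζ‖ = h / 2 := by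
      have : ((1 - h / 2 : ℝ) : ℂ) * ζ - ζ = ((-(h / 2) : ℝ) : ℂ) * ζ := by push_cast; ring
      rw [this, norm_mul, hζ, norm_real, mul_one, Real.norm_eq_abs, abs_neg,
        abs_of_pos (by linarith)]
    refine ⟨?_, fun h0 => ?_⟩
    · change ‖w‖ < 1
      have := norm_le_norm_add_norm_sub (((1 - h / 2 : ℝ) : ℂ) * ζ) w
      rw [norm_sub_rev] at this
      linarith
    · rw [hζz h0, hdist]
      have := norm_sub_le_norm_sub_add_norm_sub w (((1 - h / 2 : ℝ) : ℂ) * ζ) ζ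
      linarith
  -- The companion is centred at `r ζ`, far from the tent on the scale `h`, and `a = 1 - r`. The
  -- error is at most `2 r h + h/16`. If `r = 1 - 64h`, this is below `a/16 = 4h`; for large tents
  -- `r = 0`, and `h/16 ≤ 1/16 = a/16`.
  set r : ℝ := max 0 (1 - 64 * h) with hr
  have hr0 : 0 ≤ r := le_max_left _ _
  have hr1 : r ≤ 1 - h / 16 := max_le (by linarith) (by linarith)
  have hrz : ‖(r : ℂ) * ζ‖ = r := by rw [norm_mul, hζ, mul_one, norm_real, Real.norm_of_nonneg hr0]
  have hSd : ∀ s ∈ ball ((r : ℂ) * ζ) (h / 16), ‖s‖ < 1 := by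
    intro s hs
    rw [mem_ball, dist_eq_norm] at hs
    have := norm_le_norm_add_norm_sub ((r : ℂ) * ζ) s
    rw [norm_sub_rev] at this
    linarith
  refine ⟨ball ((r : ℂ) * ζ) (h / 16), 1 - r, h, measurableSet_ball, hSd, by linarith, hh0, ?_,
    hvol _ (by linarith), ?_, ?_⟩
  · linarith [le_max_right 0 (1 - 64 * h)]
  · refine le_trans ?_ (measure_mono hball)
    rw [hvol _ (by linarith), hvol _ (by linarith)]
    refine ENNReal.ofReal_le_ofReal ?_
    have := Real.pi_pos
    gcongr
    norm_num
  · intro t ht s hs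
    have ht1 : ‖t‖ < 1 := ht.1
    have ht2 := hT t ht
    rw [mem_ball, dist_eq_norm] at hs
    have heq : 1 - t * conj s - ((1 - r : ℝ) : ℂ) =
        (r : ℂ) * (-(t - ζ)) * conj ζ - t * conj (s - r * ζ) := by
      simp only [map_sub, map_mul, conj_ofReal]
      push_cast
      linear_combination (-(r : ℂ)) * hζc
    have hn : ‖1 - t * conj s - ((1 - r : ℝ) : ℂ)‖ ≤ r * (2 * h) + h / 16 := by
      rw [heq]
      refine (norm_sub_le _ _).trans ?_
      simp only [norm_mul, RCLike.norm_conj, hζ, norm_neg, norm_real, Real.norm_of_nonneg hr0,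
        mul_one]
      have h1 : ‖t‖ * ‖s - r * ζ‖ ≤ 1 * (h / 16) := by gcongr
      have h2 : r * ‖t - ζ‖ ≤ r * (2 * h) := by gcongr
      linarith
    refine hn.trans ?_
    rcases max_choice 0 (1 - 64 * h) with h1 | h1
    · rw [← hr] at h1
      rw [h1]; linarith
    · rw [← hr] at h1
      have : r * (2 * h) ≤ 1 * (2 * h) := by gcongr; linarith
      linarith

/-- Writing `xy = ab(1 + d)` with `d` small, `v = (1 + d)²` satisfies `Re v ≥ 1/2` and `|v| ≤ 3/2`,
so `Re v⁻¹ = Re v / |v|² ≥ 2/9`. The relative error `1/16` must be small enough for the argument of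
the product of both squared factors to stay under control. -/
lemma le_re_inv_sq_mul_inv_sq {x y : ℂ} {a b : ℝ} (ha : 0 < a) (hb : 0 < b)
    (hx : ‖x - a‖ ≤ a / 16) (hy : ‖y - b‖ ≤ b / 16) :
    2 / 9 / (a * b) ^ 2 ≤ ((x ^ 2)⁻¹ * (y ^ 2)⁻¹).re := by
  have ha' : (a : ℂ) ≠ 0 := by exact_mod_cast ha.ne'
  have hb' : (b : ℂ) ≠ 0 := by exact_mod_cast hb.ne'
  set ξ := (x - a) / a with hξ
  set η := (y - b) / b with hη
  have hξn : ‖ξ‖ ≤ 1 / 16 := by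
    rw [hξ, norm_div, norm_real, Real.norm_of_nonneg ha.le, div_le_iff₀ ha]; linarith
  have hηn : ‖η‖ ≤ 1 / 16 := by
    rw [hη, norm_div, norm_real, Real.norm_of_nonneg hb.le, div_le_iff₀ hb]; linarith
  have hxe : x = a * (1 + ξ) := by rw [hξ]; field_simp; ring
  have hye : y = b * (1 + η) := by rw [hη]; field_simp; ring
  set d := ξ + η + ξ * η with hd
  have hdn : ‖d‖ ≤ 13 / 100 := by
    have h1 : ‖ξ * η‖ ≤ 1 / 16 * (1 / 16) := by rw [norm_mul]; gcongr
    have := norm_add₃_le (a := ξ) (b := η) (c := ξ * η)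
    linarith
  set v := (1 + d) ^ 2 with hv
  have hv1 : ‖v - 1‖ ≤ 1 / 2 := by
    have : v - 1 = 2 * d + d * d := by rw [hv]; ring
    rw [this]
    refine (norm_add_le _ _).trans ?_
    rw [norm_mul, norm_mul]
    norm_num
    nlinarith [norm_nonneg d]
  have hvre : 1 / 2 ≤ v.re := by
    have h1 := (abs_re_le_norm (v - 1)).trans hv1
    rw [sub_re, one_re] at h1
    linarith [(abs_le.1 h1).1]
  have hvn : ‖v‖ ≤ 3 / 2 := by
    have := norm_le_norm_add_norm_sub (1 : ℂ) v
    rw [norm_sub_rev, norm_one] at this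
    linarith
  have hprod : (x ^ 2)⁻¹ * (y ^ 2)⁻¹ = ((((a * b) ^ 2)⁻¹ : ℝ) : ℂ) * v⁻¹ := by
    rw [← mul_inv, hxe, hye, ofReal_inv, ← mul_inv, hv, hd]
    push_cast
    ring
  rw [hprod, re_ofReal_mul, inv_re, div_eq_inv_mul]
  have hab : 0 < ((a * b) ^ 2)⁻¹ := by positivity
  have hv0 : 0 < normSq v := by
    rw [normSq_pos]; rintro h0; rw [h0] at hvre; norm_num at hvre
  refine mul_le_mul_of_nonneg_left ?_ hab.le
  rw [le_div_iff₀ hv0, normSq_eq_norm_sq]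
  nlinarith [norm_nonneg v]

/-! ### The bound on the characteristic. -/

/-- The numerical constant of the lower bound. -/
noncomputable def lowerConst : ℝ≥0 := 2 ^ 43

section

variable {p : ℝ} {μ : ℂ × ℂ → ℝ}

lemma laverage_mul_rpow_le (hp : 1 < p) (hμ : IsWeight μ) {N : ℝ≥0∞} (hN : IsBound p μ N)
    {z₁ z₂ : ℂ} (h₁ : z₁ ∈ disc) (h₂ : z₂ ∈ disc) :
    (⨍⁻ w in inducedTent z₁ z₂, ENNReal.ofReal (scaledWeight p μ w) ∂uMeasure) *
      (⨍⁻ w in inducedTent z₁ z₂, ENNReal.ofReal (scaledDual p μ w) ∂uMeasure) ^ (p - 1) ≤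
      (lowerConst * N) ^ (2 * p) := by
  have hp0 : 0 < p := by linarith
  obtain ⟨S₁, a₁, k₁, hS₁, hSd₁, ha₁, hk₁, hak₁, hv₁, hle₁, hker₁⟩ := exists_companion h₁
  obtain ⟨S₂, a₂, k₂, hS₂, hSd₂, ha₂, hk₂, hak₂, hv₂, hle₂, hker₂⟩ := exists_companion h₂
  have hT : inducedTent z₁ z₂ = hartogsProd (carlesonTent z₁) (carlesonTent z₂) := rfl
  rw [hT]
  set T := hartogsProd (carlesonTent z₁) (carlesonTent z₂)
  set S := hartogsProd S₁ S₂
  have hTm : MeasurableSet T :=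
    measurableSet_hartogsProd (measurableSet_carlesonTent _) (measurableSet_carlesonTent _)
  have hSm : MeasurableSet S := measurableSet_hartogsProd hS₁ hS₂
  have huT : uMeasure T = volume (carlesonTent z₁) * volume (carlesonTent z₂) :=
    uMeasure_hartogsProd (measurableSet_carlesonTent _) (measurableSet_carlesonTent _)
      (carlesonTent_subset_disc _) (carlesonTent_subset_disc _)
  have huS : uMeasure S = volume S₁ * volume S₂ := uMeasure_hartogsProd hS₁ hS₂ hSd₁ hSd₂
  have hST : uMeasure S ≤ uMeasure T := by rw [huS, huT]; gcongr
  have huS' : uMeasure S =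
      ENNReal.ofReal (Real.pi * (k₁ / 16) ^ 2 * (Real.pi * (k₂ / 16) ^ 2)) := by
    rw [huS, hv₁, hv₂, ← ENNReal.ofReal_mul (by positivity)]
  have hS0 : uMeasure S ≠ 0 := by
    rw [huS', ne_eq, ENNReal.ofReal_eq_zero, not_le]; positivity
  have hStop : uMeasure S ≠ ∞ := by rw [huS']; exact ENNReal.ofReal_ne_top
  set δ : ℝ := 2 / 9 / (a₁ * a₂) ^ 2 with hδ
  have hδ0 : 0 < δ := by positivity
  have hker : ∀ z ∈ T, ∀ w ∈ S, δ ≤ (bidiscKernel z w).re := fun z hz w hw =>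
    le_re_inv_sq_mul_inv_sq ha₁ ha₂ (hker₁ _ hz.2.1 _ hw.2.1) (hker₂ _ hz.2.2 _ hw.2.2)
  -- Hermitian symmetry lets tent and companion exchange roles.
  have hflip : ∀ {t s : ℂ} {a : ℝ}, ‖1 - t * conj s - a‖ = ‖1 - s * conj t - a‖ := by
    intro t s a
    rw [← RCLike.norm_conj]
    simp [mul_comm]
  have hker' : ∀ z ∈ S, ∀ w ∈ T, δ ≤ (bidiscKernel z w).re := fun z hz w hw =>
    le_re_inv_sq_mul_inv_sq ha₁ ha₂ (hflip.trans_le (hker₁ _ hw.2.1 _ hz.2.1))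
      (hflip.trans_le (hker₂ _ hw.2.2 _ hz.2.2))
  have e1 := setLIntegral_mul_rpow_le hp hμ hN hTm (hartogsProd_subset _ _) hSm
    (hartogsProd_subset _ _) hδ0 hker'
  have e2 := setLIntegral_mul_rpow_le hp hμ hN hSm (hartogsProd_subset _ _) hTm
    (hartogsProd_subset _ _) hδ0 hker
  have e3 := uMeasure_rpow_le hp hμ (F := S) (hartogsProd_subset _ _)
  have hD : ENNReal.ofReal (Real.pi ^ 2 / δ) ≤ lowerConst * uMeasure S := by
    have hK : (lowerConst : ℝ≥0∞) = ENNReal.ofReal (2 ^ 43) := by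
      rw [lowerConst, ← ENNReal.ofReal_coe_nnreal]; norm_num
    rw [huS', hK, ← ENNReal.ofReal_mul (by positivity)]
    refine ENNReal.ofReal_le_ofReal ?_
    have hab : (a₁ * a₂) ^ 2 ≤ (64 * k₁ * (64 * k₂)) ^ 2 := by gcongr
    rw [hδ, div_div_eq_mul_div]
    calc Real.pi ^ 2 * (a₁ * a₂) ^ 2 / (2 / 9)
        ≤ Real.pi ^ 2 * (64 * k₁ * (64 * k₂)) ^ 2 / (2 / 9) := by gcongr
      -- Here `64⁴ · 16⁴ · 9/2 = 9 · 2³⁹`, which is at most `2⁴³`.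
      _ = (9 * 2 ^ 39) * (Real.pi * (k₁ / 16) ^ 2 * (Real.pi * (k₂ / 16) ^ 2)) := by ring
      _ ≤ _ := by gcongr; norm_num
  set D := ENNReal.ofReal (Real.pi ^ 2 / δ)
  have hD' : D ≤ lowerConst * uMeasure T := hD.trans (by gcongr)
  set WT := ∫⁻ w in T, ENNReal.ofReal (scaledWeight p μ w) ∂uMeasure
  set WS := ∫⁻ w in S, ENNReal.ofReal (scaledWeight p μ w) ∂uMeasure
  set σT := ∫⁻ w in T, ENNReal.ofReal (scaledDual p μ w) ∂uMeasure
  set σS := ∫⁻ w in S, ENNReal.ofReal (scaledDual p μ w) ∂uMeasure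
  have hX : WT * σT ^ (p - 1) ≤ (lowerConst * N) ^ (2 * p) * uMeasure T ^ p := by
    have hbp0 : uMeasure S ^ p ≠ 0 := (ENNReal.rpow_pos (pos_iff_ne_zero.2 hS0) hStop).ne'
    have hbpt : uMeasure S ^ p ≠ ∞ := ENNReal.rpow_ne_top_of_nonneg hp0.le hStop
    -- Multiplying by `u(S)^p` brings in Hölder on `S`; the four integrals then regroup into the two
    -- off-diagonal products.
    rw [← ENNReal.mul_le_mul_iff_left hbp0 hbpt]
    calc WT * σT ^ (p - 1) * uMeasure S ^ p
        ≤ WT * σT ^ (p - 1) * (WS * σS ^ (p - 1)) := by gcongr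
      _ = (WS * σT ^ (p - 1)) * (WT * σS ^ (p - 1)) := by ring
      _ ≤ (D ^ p * N ^ p) * (D ^ p * N ^ p) := by gcongr
      _ ≤ ((lowerConst * uMeasure T) ^ p * N ^ p) * ((lowerConst * uMeasure S) ^ p * N ^ p) := by
          gcongr
      _ = _ := by
          rw [two_mul, ENNReal.rpow_add_of_nonneg _ _ hp0.le hp0.le]
          simp only [ENNReal.mul_rpow_of_nonneg _ _ hp0.le]
          ring
  rw [setLAverage_eq, setLAverage_eq, ENNReal.div_rpow_of_nonneg _ _ (by linarith)]
  have hT0 : uMeasure T ≠ 0 := fun h => hS0 (le_antisymm (h ▸ hST) zero_le)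
  have hTtop : uMeasure T ≠ ∞ :=
    ((measure_mono (hartogsProd_subset _ _)).trans_lt uMeasure_hartogs_lt_top).ne
  have hTp : uMeasure T ^ p = uMeasure T * uMeasure T ^ (p - 1) := by
    nth_rw 2 [← ENNReal.rpow_one (uMeasure T)]
    rw [← ENNReal.rpow_add _ _ hT0 hTtop, add_sub_cancel]
  rw [ENNReal.div_eq_inv_mul, ENNReal.div_eq_inv_mul, mul_mul_mul_comm,
    ← ENNReal.mul_inv (Or.inl hT0) (Or.inl hTtop), ← hTp, mul_comm, ← div_eq_mul_inv]
  exact ENNReal.div_le_of_le_mul hX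

lemma characteristic_le (hp : 1 < p) (hμ : IsWeight μ) {N : ℝ≥0∞} (hN : IsBound p μ N) :
    characteristic p μ (dualWeight p μ) ≤ (lowerConst * N) ^ (2 * p) :=
  iSup₂_le fun _ h₁ => iSup₂_le fun _ h₂ => laverage_mul_rpow_le hp hμ hN h₁ h₂

end

end HartogsBergman

theorem corollary5p1 :
    ∃ C : ℝ≥0, 0 < C ∧ ∀ (p : ℝ), 1 < p → ∀ μ : ℂ × ℂ → ℝ, HartogsBergman.IsWeight μ →
      HartogsBergman.IsBoundedOn p μ →
        HartogsBergman.characteristic p μ (HartogsBergman.dualWeight p μ) < ∞ ∧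
        HartogsBergman.characteristic p μ (HartogsBergman.dualWeight p μ) ^ (1 / (2 * p)) ≤
          (C : ℝ≥0∞) * HartogsBergman.projectionNorm p μ := by
  have hC : (0 : ℝ≥0) < HartogsBergman.lowerConst := by
    unfold HartogsBergman.lowerConst; positivity
  refine ⟨HartogsBergman.lowerConst, hC, fun p hp μ hμ hb => ⟨?_, ?_⟩⟩
  · obtain ⟨N, hN⟩ := hb
    refine (HartogsBergman.characteristic_le hp hμ hN).trans_lt ?_
    exact ENNReal.rpow_lt_top_of_nonneg (by linarith)
      (ENNReal.mul_ne_top ENNReal.coe_ne_top ENNReal.coe_ne_top)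
  -- With the constant moved to the left, the claim says that a fixed number is a lower bound for
  -- the set whose infimum is the norm, so each `N` can be treated separately.
  · rw [mul_comm (HartogsBergman.lowerConst : ℝ≥0∞), ← ENNReal.div_le_iff_le_mul
      (Or.inl (ENNReal.coe_ne_zero.2 hC.ne')) (Or.inl ENNReal.coe_ne_top)]
    refine le_sInf fun N hN => ?_
    rw [ENNReal.div_le_iff_le_mul
      (Or.inl (ENNReal.coe_ne_zero.2 hC.ne')) (Or.inl ENNReal.coe_ne_top), mul_comm N]
    have h := ENNReal.rpow_le_rpow (HartogsBergman.characteristic_le hp hμ hN)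
      (z := 1 / (2 * p)) (by positivity)
    rwa [← ENNReal.rpow_mul, mul_one_div_cancel (by positivity), ENNReal.rpow_one] at h
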